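/- Notation ($\mathfrak g=sl_2$). Let $\mathcal Y_t$ be the $\mathbb Z[t^{\pm}]$-algebra generated by $\tilde Y_l^{\pm 1}$ ($l\in\mathbb Z$) with $t$ central and relations $\tilde Y_l\tilde Y_k=t^{\gamma(l-k)}\tilde Y_k\tilde Y_l$, where $\gamma(-d)=-\gamma(d)$, $\gamma(d)=0$ for $d$ odd, and $\gamma(2r)=2(-1)^r$ for $r\ge 1$. Put $\tilde A_l=\tilde Y_{l+1}\tilde Y_{l-1}$. A $\mathcal Y_t$-monomial is a product of elements $t^{\pm1},\tilde Y_l^{\pm 1}$. Such a monomial $m$ equals $\prod_l\tilde Y_l^{u_l(m)}$ (factors in increasing order of $l$) up to a power of $t$, and $\pi_+(m)=\prod_l Y_l^{u_l(m)}$ denotes its image in the commutative ring $\mathbb Z[Y_l^{\pm1}]_{l\in\mathbb Z}$; let $A_l=\pi_+(\tilde A_l)=Y_{l-1}Y_{l+1}$. Call $m$ dominant if all $u_l(m)\ge 0$, and let $t^{\mathbb Z}B$ be the set of dominant monomials. Write $m'<m$ if $\pi_+(m')\ne\pi_+(m)$ and $\pi_+(m'm^{-1})=A_{i_1}^{-1}\cdots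 A_{i_R}^{-1}$ for some $i_1,\dots,i_R\in\mathbb Z$; then $R=R(m')\geq 1$ is uniquely determined. Let $x\mapsto\overline x$ be the antimultiplicative $\mathbb Z$-linear involution of $\mathcal Y_t$ with $\overline t=t^{-1}$, $\overline{\tilde Y_l}=t^{-1}\tilde Y_l$; for a monomial $m$, $\overline m m^{-1}$ is a power of $t$. Let $\mathfrak K_t\subset\mathcal Y_t$ be the kernel of the $t$-screening operator: the $\mathbb Z[t^{\pm}]$-linear map from $\mathcal Y_t$ to the left $\mathcal Y_t$-module generated by $\tilde S_l$ ($l\in\mathbb Z$) with relations $\tilde A_l\tilde S_{l-1}=t^{-1}\tilde S_{l+1}$, sending each monomial $m$ to $\sum_l\frac{t^{2u_l(m)}-1}{t^2-1}\,m\tilde S_l$. For $m\in t^{\mathbb Z}B$ let $F_t(m)$ be the unique element of $\mathfrak K_t$ whose only dominant monomial is $m$, with coefficient $1$, and $$E_t(m)=m\Big(\prod_{l}^{\rightarrow}\tilde Y_l^{u_l(m)}\Big)^{-1}\prod_{l}^{\rightarrow}s_l\big(F_t(\tilde Y_0)\big)^{u_l(m)},$$ with products in increasing order of $l$ and $s_l$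 the algebra endomorphism $\tilde Y_k\mapsto\tilde Y_{k+l}$, $t\mapsto t$. Let $A^{\rm inv}_m$ be the set of all $t^{\alpha}mx$ with $x$ a product of elements $\tilde A_l^{-1}$ and $\alpha\in\mathbb Z$ such that $\overline{t^{\alpha}mx}=t^{\alpha}\overline m x$, and let $B^{\rm inv}_m=t^{\mathbb Z}B\cap A^{\rm inv}_m$; the set $\{m'\in B^{\rm inv}_m: m'<m\}$ is finite. Let $L_t(m)\in\mathfrak K_t$ and $P_{m',m}(t)\in t^{-1}\mathbb Z[t^{-1}]$ (for $m\in t^{\mathbb Z}B$, $m'\in B^{\rm inv}_m$, $m'<m$) be the unique families such that for all $m\in t^{\mathbb Z}B$ $$\overline{L_t(m)}=(\overline m m^{-1})L_t(m),\qquad E_t(m)=L_t(m)+\sum_{m'<m,\ m'\in B^{\rm inv}_m}P_{m',m}(t)L_t(m').$$ Statement. All these objects are well defined, that is, $F_t(m)$ exists and is unique for each $m\in t^{\mathbb Z}B$, and the families $(L_t(m))$, $(P_{m',m}(t))$ exist and are unique. Let $m\in t^{\mathbb Z}B$ with $u_l(m)\le 1$ for all $l\in\mathbb Z$. Then $L_t(m)=F_t(m)$,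 and $$E_t(m)=L_t(m)+\sum_{m'<m,\ m'\in B^{\rm inv}_m}t^{-R(m')}L_t(m'),$$ where $R(m')\ge 1$ is given by $\pi_+(m'm^{-1})=A_{i_1}^{-1}\cdots A_{i_{R(m')}}^{-1}$. In particular $P_{m',m}(t)=t^{-R(m')}$ for every $m'\in B^{\rm inv}_m$ with $m'<m$. -/

import Mathlib

open scoped LaurentPolynomial

/-!
The `t`-deformed algebra `𝒴_t` of type `sl₂`, its screening operator, its bar involution, and the
elements `F_t(m)`, `E_t(m)`, `L_t(m)` and polynomials `P_{m',m}(t)`.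
The index set `I` has one element, `r₁ = 1`, `C(z) = z + z⁻¹`.
-/

namespace QTsl2

/-- `ctilde r` is the coefficient of `z ^ r` in the expansion of
`C̃(z) = 1 / (z + z⁻¹) = ∑_{j ≥ 0} (-1)^j z^{-2j-1}` in `ℤ((z⁻¹))`. -/
def ctilde (r : ℤ) : ℤ :=
  if r < 0 ∧ r % 2 = 1 then (-1) ^ ((-r - 1) / 2).toNat else 0

/-- `C(z) * C̃(z) = 1`. -/
theorem ctilde_spec (r : ℤ) : ctilde (r - 1) + ctilde (r + 1) = if r = 0 then 1 else 0 := by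
  by_cases h0 : r = 0
  · subst h0; decide
  · rw [if_neg h0]
    unfold ctilde
    rcases lt_or_gt_of_ne h0 with h | h
    · by_cases h2 : r % 2 = 0
      · rw [if_pos (by omega), if_pos (by omega)]
        have : ((-(r - 1) - 1) / 2).toNat = ((-(r + 1) - 1) / 2).toNat + 1 := by omega
        rw [this, pow_succ]; ring
      · rw [if_neg (by omega), if_neg (by omega)]; rfl
    · rw [if_neg (by omega), if_neg (by omega)]; rfl

/-- The exponent `𝒩(Y_l, Y_k)` in `Ỹ_l Ỹ_k = t ^ 𝒩(Y_l, Y_k) :Ỹ_l Ỹ_k:`, as a function of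
`d = l - k`. -/
def nu (d : ℤ) : ℤ := ctilde (d + 1) - ctilde (d - 1)

/-- The bicharacter `𝒩` on (exponent vectors of) commutative Laurent monomials in the `Y_l`. -/
def bichar (u v : ℤ →₀ ℤ) : ℤ :=
  u.sum fun l a => v.sum fun k b => a * b * nu (l - k)

theorem bichar_zero_left (v : ℤ →₀ ℤ) : bichar 0 v = 0 := by simp [bichar]

theorem bichar_zero_right (u : ℤ →₀ ℤ) : bichar u 0 = 0 := by simp [bichar]

theorem bichar_add_left (u u' v : ℤ →₀ ℤ) : bichar (u + u') v = bichar u v + bichar u' v := by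
  unfold bichar
  rw [Finsupp.sum_add_index']
  · intro l; simp
  · intro l a b
    rw [← Finsupp.sum_add]
    congr 1; funext k c; ring

theorem bichar_add_right (u v v' : ℤ →₀ ℤ) : bichar u (v + v') = bichar u v + bichar u v' := by
  unfold bichar
  rw [← Finsupp.sum_add]
  congr 1; funext l a
  rw [Finsupp.sum_add_index']
  · intro l; simp
  · intro k b c; ring

theorem bichar_neg_left (u v : ℤ →₀ ℤ) : bichar (-u) v = -bichar u v := by
  have h := bichar_add_left (-u) u v
  rw [neg_add_cancel, bichar_zero_left] at h
  omega

/-- The `𝒴_t`-monomials. The element `⟨a, u⟩` is `t ^ a :∏_l Ỹ_l ^ (u l):`. -/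
@[ext]
structure YMon where
  /-- exponent of `t`, relative to the normally ordered monomial -/
  a : ℤ
  /-- the exponents `u_l` -/
  u : ℤ →₀ ℤ

namespace YMon

/-- The monomials form a group, with `:m₁: :m₂: = t ^ 𝒩(m₁, m₂) :m₁ m₂:`. -/
noncomputable instance : Group YMon where
  mul g h := ⟨g.a + h.a + bichar g.u h.u, g.u + h.u⟩
  one := ⟨0, 0⟩
  inv g := ⟨-g.a + bichar g.u g.u, -g.u⟩
  mul_assoc x y z := by
    refine YMon.ext ?_ (add_assoc x.u y.u z.u)
    change x.a + y.a + bichar x.u y.u + z.a + bichar (x.u + y.u) z.u =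
      x.a + (y.a + z.a + bichar y.u z.u) + bichar x.u (y.u + z.u)
    rw [bichar_add_left, bichar_add_right]; ring
  one_mul x := by
    refine YMon.ext ?_ (zero_add x.u)
    change 0 + x.a + bichar 0 x.u = x.a
    rw [bichar_zero_left]; ring
  mul_one x := by
    refine YMon.ext ?_ (add_zero x.u)
    change x.a + 0 + bichar x.u 0 = x.a
    rw [bichar_zero_right]; ring
  inv_mul_cancel x := by
    refine YMon.ext ?_ (neg_add_cancel x.u)
    change -x.a + bichar x.u x.u + x.a + bichar (-x.u) x.u = 0
    rw [bichar_neg_left]; ring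

theorem mul_a (g h : YMon) : (g * h).a = g.a + h.a + bichar g.u h.u := rfl

theorem mul_u (g h : YMon) : (g * h).u = g.u + h.u := rfl

/-- The central element `t ^ n`. -/
def t (n : ℤ) : YMon := ⟨n, 0⟩

/-- `Ỹ_l`. -/
noncomputable def Y (l : ℤ) : YMon := ⟨0, Finsupp.single l 1⟩

/-- The exponent vector of `A_l = Y_{l-1} Y_{l+1}`. -/
noncomputable def alpha (l : ℤ) : ℤ →₀ ℤ := Finsupp.single (l - 1) 1 + Finsupp.single (l + 1) 1

/-- `Ã_l = :Ỹ_{l-1} Ỹ_{l+1}:`. -/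
noncomputable def A (l : ℤ) : YMon := ⟨0, alpha l⟩

/-- The effect of the involution on monomials: the unique antimultiplicative map with
`t ↦ t⁻¹` and `Ỹ_l ↦ t⁻¹ Ỹ_l`. Applied to `t^a :m: = t^a π_+(m) π_-(m)` it gives
`t^{-a} π_-(m) π_+(m)`. -/
def bar (g : YMon) : YMon := ⟨-g.a + bichar g.u g.u, g.u⟩

theorem bar_mul (g h : YMon) : bar (g * h) = bar h * bar g := by
  refine YMon.ext ?_ (add_comm g.u h.u)
  change -(g.a + h.a + bichar g.u h.u) + bichar (g.u + h.u) (g.u + h.u) =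
    -h.a + bichar h.u h.u + (-g.a + bichar g.u g.u) + bichar h.u g.u
  rw [bichar_add_left, bichar_add_right, bichar_add_right]; ring

theorem bar_t (n : ℤ) : bar (t n) = t (-n) := by
  simp [bar, t, bichar_zero_left]

theorem bar_Y (l : ℤ) : bar (Y l) = t (-1) * Y l := by
  refine YMon.ext ?_ (zero_add _).symm
  simp [bar, mul_a, t, Y, bichar, nu, ctilde]

/-- The shift `s_k : Ỹ_l ↦ Ỹ_{l+k}` on monomials. -/
noncomputable def shift (k : ℤ) (g : YMon) : YMon := ⟨g.a, g.u.mapDomain (· + k)⟩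

/-- Membership in `t^ℤ B`. -/
def Dominant (g : YMon) : Prop := ∀ l, 0 ≤ g.u l

/-- The `𝒴_t^A`-monomials: products of the `Ã_l⁻¹`. -/
noncomputable def AMonomials : Submonoid YMon := Submonoid.closure (Set.range fun l => (A l)⁻¹)

/-- `g ∈ A^inv_M`: `g = t^α M x` for a `𝒴_t^A`-monomial `x` and the `α` such that
`bar (t^α M x) = t^α (bar M) x`. -/
def AInv (M g : YMon) : Prop :=
  ∃ x ∈ AMonomials, ∃ α : ℤ, g = t α * M * x ∧ bar g = t α * bar M * x

/-- `w = A_{i_1}⁻¹ ⋯ A_{i_R}⁻¹` for some `i_1, …, i_R`, in exponent vectors. -/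
def IsAProd (R : ℕ) (w : ℤ →₀ ℤ) : Prop := ∃ i : Fin R → ℤ, w = -∑ j, alpha (i j)

/-- `m' < m` : `π_+(m') ≠ π_+(m)`, and `π_+(m' m⁻¹)` is a product of elements `A_l⁻¹`. -/
def Lt (m' m : YMon) : Prop := m'.u ≠ m.u ∧ ∃ R, IsAProd R (m' * m⁻¹).u

/-- The number `R` of factors in `π_+(m' m⁻¹) = A_{i_1}⁻¹ ⋯ A_{i_R}⁻¹`. -/
noncomputable def numA (m' m : YMon) : ℕ := sInf {R | IsAProd R (m' * m⁻¹).u}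

theorem isAProd_unique {R S : ℕ} {w : ℤ →₀ ℤ} (hR : IsAProd R w) (hS : IsAProd S w) : R = S := by
  have key : ∀ (n : ℕ) (i : Fin n → ℤ),
      Finsupp.liftAddHom (fun _ : ℤ => AddMonoidHom.id ℤ) (∑ j, alpha (i j)) = 2 * n := by
    intro n i
    rw [map_sum]
    simp only [alpha, map_add, Finsupp.liftAddHom_apply_single, AddMonoidHom.id_apply]
    simp [mul_comm]
  obtain ⟨i, hi⟩ := hR
  obtain ⟨k, hk⟩ := hS
  have h1 := key R i
  have h2 := key S k
  rw [neg_injective (hi.symm.trans hk)] at h1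
  omega

theorem numA_eq {R : ℕ} {m' m : YMon} (h : IsAProd R (m' * m⁻¹).u) : numA m' m = R := by
  have : {R | IsAProd R (m' * m⁻¹).u} = {R} := by
    ext S
    exact ⟨fun hS => isAProd_unique hS h, fun hS => by rw [hS]; exact h⟩
  rw [numA, this, csInf_singleton]

end YMon

/-- `t^ℤ B`, the dominant `𝒴_t`-monomials. -/
def DomMon : Type := {g : YMon // g.Dominant}

/-- `𝒴_t`, the twisted Laurent polynomial algebra: the free `ℤ`-module on the `𝒴_t`-monomials
`t^a :m:`, i.e. the free `ℤ[t^±]`-module on the `:m:`. -/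
abbrev Yt : Type := MonoidAlgebra ℤ YMon

/-- A monomial, as an element of `𝒴_t`. -/
noncomputable def mon (g : YMon) : Yt := MonoidAlgebra.single g 1

/-- The inclusion of the scalars `ℤ[t^±]` in `𝒴_t`. -/
noncomputable def scalar (p : ℤ[T;T⁻¹]) : Yt :=
  p.coeff.sum fun n c => MonoidAlgebra.single (YMon.t n) c

/-- The involution of `𝒴_t`. -/
noncomputable def bar (x : Yt) : Yt := MonoidAlgebra.mapDomain YMon.bar x

/-- The shift `s_k` of `𝒴_t`. -/
noncomputable def shift (k : ℤ) (x : Yt) : Yt := MonoidAlgebra.mapDomain (YMon.shift k) x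

/-- The left `𝒴_t`-module generated by the `S̃_l`, `l ∈ ℤ`, with relations
`Ã_l S̃_{l-1} = t⁻¹ S̃_{l+1}`. -/
abbrev ScreenMod : Type :=
  (ℤ →₀ Yt) ⧸ Submodule.span Yt (Set.range fun l : ℤ =>
    Finsupp.single (l - 1) (mon (YMon.A l)) - Finsupp.single (l + 1) (mon (YMon.t (-1))))

/-- The generator `S̃_l`. -/
noncomputable def S (l : ℤ) : ScreenMod := Submodule.Quotient.mk (Finsupp.single l 1)

/-- `(t^{2n} - 1) / (t² - 1)` in `ℤ[t^±]`, for `n ∈ ℤ`. -/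
noncomputable def tnum (n : ℤ) : ℤ[T;T⁻¹] :=
  if 0 ≤ n then ∑ j ∈ Finset.range n.toNat, LaurentPolynomial.T (2 * (j : ℤ))
  else -∑ j ∈ Finset.range (-n).toNat, LaurentPolynomial.T (-2 * ((j : ℤ) + 1))

theorem tnum_spec (n : ℤ) :
    (LaurentPolynomial.T 2 - 1) * tnum n = LaurentPolynomial.T (2 * n) - 1 := by
  unfold tnum
  split_ifs with h
  · obtain ⟨k, rfl⟩ := Int.eq_ofNat_of_zero_le h
    simp only [Int.toNat_natCast]
    rw [Finset.mul_sum, ← LaurentPolynomial.T_zero]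
    simp only [sub_mul, ← LaurentPolynomial.T_add]
    have := Finset.sum_range_sub (fun j : ℕ => (LaurentPolynomial.T (2 * (j : ℤ)) : ℤ[T;T⁻¹])) k
    simpa [mul_add, add_comm] using this
  · obtain ⟨k, hk⟩ := Int.eq_ofNat_of_zero_le (a := -n) (by omega)
    obtain rfl : n = -k := by omega
    simp only [neg_neg, Int.toNat_natCast]
    rw [mul_neg, Finset.mul_sum, ← LaurentPolynomial.T_zero]
    simp only [sub_mul, ← LaurentPolynomial.T_add]
    have := Finset.sum_range_sub' (fun j : ℕ => (LaurentPolynomial.T (-2 * (j : ℤ)) : ℤ[T;T⁻¹])) k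
    have h2 : ∀ j : ℤ, 2 + -2 * (j + 1) = -2 * j := fun j => by ring
    simp only [h2, zero_add]
    push_cast at this
    rw [this]
    simp

/-- The `t`-screening operator `λ ↦ (t² - 1)⁻¹ ∑_l [S̃_l, λ]`. As
`S̃_l m = t^{2 u_l(m)} m S̃_l`, its value at a monomial `m` is
`∑_l ((t^{2 u_l(m)} - 1) / (t² - 1)) m S̃_l`. -/
noncomputable def screening (x : Yt) : ScreenMod :=
  x.coeff.sum fun g c => c • g.u.sum fun l n => (scalar (tnum n) * mon g) • S l

/-- `x ∈ 𝔎_t`, the kernel of the screening operator. -/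
def InKt (x : Yt) : Prop := screening x = 0

/-- `x ∈ 𝔎_t`, and `m` is the unique dominant monomial of `x`, with coefficient `1`. -/
def IsFt (m : DomMon) (x : Yt) : Prop :=
  InKt x ∧ x.coeff m.1 = 1 ∧ ∀ g : YMon, g.Dominant → g ≠ m.1 → x.coeff g = 0

/-- `F_t(m)`, the unique `x` such that `IsFt m x`. -/
noncomputable def Ft (m : DomMon) : Yt := Classical.epsilon (IsFt m)

/-- The ordered product `⋯ f(-1) f(0) f(1) ⋯` over a finite set of integers. -/
noncomputable def orderedProd {G : Type*} [Monoid G] (s : Finset ℤ) (f : ℤ → G) : G :=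
  ((s.sort (· ≤ ·)).map f).prod

/-- `Ỹ_0` as a dominant monomial. -/
noncomputable def Y0 : DomMon := ⟨YMon.Y 0, fun l => by
  simp only [YMon.Y, Finsupp.single_apply]; split_ifs <;> decide⟩

/-- `E_t(m) = m (∏^→ Ỹ_l^{u_l(m)})⁻¹ ∏^→ s_l(F_t(Ỹ_0))^{u_l(m)}`. -/
noncomputable def Et (m : DomMon) : Yt :=
  mon (m.1 * (orderedProd m.1.u.support fun l => YMon.Y l ^ m.1.u l)⁻¹) *
    orderedProd m.1.u.support fun l => shift l (Ft Y0) ^ (m.1.u l).toNat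

/-- `{m' ∈ B^inv_m | m' < m}`, where `B^inv_m = t^ℤ B ∩ A^inv_m`. -/
def lower (m : DomMon) : Set DomMon := {m' | YMon.AInv m.1 m'.1 ∧ YMon.Lt m'.1 m.1}

theorem lower_finite (m : DomMon) : (lower m).Finite := by
  refine Set.Finite.of_finite_image (f := fun m' : DomMon => m'.1.u)
    ((Set.finite_Icc (0 : ℤ →₀ ℤ) m.1.u).subset ?_) ?_
  · rintro _ ⟨m', ⟨-, -, R, i, hi⟩, rfl⟩
    refine ⟨fun l => m'.2 l, fun l => ?_⟩
    have h1 : m'.1.u + -m.1.u = -∑ j, YMon.alpha (i j) := hi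
    have h2 := DFunLike.congr_fun h1 l
    have h3 : 0 ≤ (∑ j, YMon.alpha (i j)) l := by
      rw [Finsupp.finsetSum_apply]
      refine Finset.sum_nonneg fun j _ => ?_
      simp only [YMon.alpha, Finsupp.add_apply, Finsupp.single_apply]
      split_ifs <;> decide
    simp only [Finsupp.add_apply, Finsupp.neg_apply] at h2
    change m'.1.u l ≤ m.1.u l
    omega
  · rintro m₁ ⟨⟨x, -, α, h1, h1'⟩, -⟩ m₂ ⟨⟨y, -, β, h2, h2'⟩, -⟩ h
    have key : ∀ (g z : YMon) (γ : ℤ), g = YMon.t γ * m.1 * z →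
        g.bar = YMon.t γ * m.1.bar * z →
        2 * g.a = bichar g.u g.u + 2 * m.1.a - bichar m.1.u m.1.u := by
      intro g z γ h h'
      have e1 := congrArg YMon.a h
      have e2 := congrArg YMon.a h'
      simp only [YMon.mul_a, YMon.mul_u, YMon.t, YMon.bar, bichar_zero_left, zero_add] at e1 e2
      omega
    have k1 := key _ _ _ h1 h1'
    have k2 := key _ _ _ h2 h2'
    have h : m₁.1.u = m₂.1.u := h
    rw [← h] at k2
    exact Subtype.ext (YMon.ext (by omega) h)

/-- `(L, P)` is the family `L_t(m)`, `P_{m',m}(t)` (extended by `P_{m',m} = 0` outside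
`m' ∈ B^inv_m`, `m' < m`): for all `m ∈ t^ℤ B`, `L_t(m) ∈ 𝔎_t`,
`bar L_t(m) = (bar m) m⁻¹ L_t(m)`, `E_t(m) = L_t(m) + ∑ P_{m',m}(t) L_t(m')`, and
`P_{m',m}(t) ∈ t⁻¹ ℤ[t⁻¹]`. -/
structure IsKL (L : DomMon → Yt) (P : DomMon → DomMon → ℤ[T;T⁻¹]) : Prop where
  mem (m : DomMon) : InKt (L m)
  bar_eq (m : DomMon) : bar (L m) = mon (m.1.bar * m.1⁻¹) * L m
  expand (m : DomMon) :
    Et m = L m + ∑ m' ∈ (lower_finite m).toFinset, scalar (P m' m) * L m'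
  neg (m m' : DomMon) (n : ℤ) : 0 ≤ n → (P m' m).coeff n = 0
  zero (m m' : DomMon) : m' ∉ lower m → P m' m = 0

/-- The pair of families `(L_t, P)`, the unique one such that `IsKL L P`. -/
noncomputable def klPair : (DomMon → Yt) × (DomMon → DomMon → ℤ[T;T⁻¹]) :=
  Classical.epsilon fun q => IsKL q.1 q.2

/-- `L_t(m)`. -/
noncomputable def Lt (m : DomMon) : Yt := klPair.1 m

/-- The Kazhdan–Lusztig analogue `P_{m',m}(t)`. -/
noncomputable def KLpoly (m' m : DomMon) : ℤ[T;T⁻¹] := klPair.2 m' m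

end QTsl2

namespace QTsl2

open Filter

/-! Everything rests on one rigidity fact (`InKt.ext`): an element of `𝔎_t` is determined by its
coefficients at dominant monomials.

Rigidity. After multiplication by `t² - 1` the screening operator is `x ↦ ∑_l [S̃_l, x]`. For each
parity of `l` all `S̃_l` are monomial multiples of a single `S̃_p`, so membership in `𝔎_t` says that
`x` commutes with a formal sum of monomials times `S̃_p` (`inKt_iff_sSum`). In this form `𝔎_t` is
visibly closed under products and under the bar involution. Comparing components of extreme degree
in one variable `Ỹ_l` after another, starting from the lowest index, shows that a nonzero element of
`𝔎_t` has a dominant monomial (`InKt.exists_dominant`).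

Well-definedness. `E_t(m)` has leading monomial `m`. Subtracting multiples of `F_t(m')` for lower
`m'` removes its other dominant monomials, which gives `F_t(m)` by induction on the degree. By
rigidity `F_t(m)` is bar invariant. The usual Kazhdan–Lusztig argument then applies: existence comes
from splitting a Laurent polynomial into a bar-invariant part and a part in `t⁻¹ ℤ[t⁻¹]`, uniqueness
from the fact that only `0` is of both kinds.

Multiplicity-free `m`. With `s` the support of `m`, the product of the `Ỹ_l + Ỹ_{l+2}⁻¹` expands
over subsets `J ⊆ s`. The term of `J` has exponent vector that of `m ∏_{l ∈ J} A_{l+1}⁻¹`, and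
relative to normal ordering it carries the extra power `t^{-#{l ∈ J : l + 2 ∈ s \ J}}`
(`orderedProd_fund`). If the term is dominant, every `l ∈ J` has `l + 2 ∈ s \ J`, so the power is
`t^{-|J|}` with `|J| = R(m')`. Distinct `J` give distinct monomials, so by rigidity `E_t(m) = F_t(m)
+ ∑ t^{-R(m')} F_t(m')`. As `R(m') ≥ 1` and the lower `m'` are again multiplicity-free, uniqueness
of the Kazhdan–Lusztig expansion yields `L_t = F_t` by induction. -/

/-! ### The bicharacter against the `A_l`, and the cone they generate. -/

/-- `nu` is a difference of two translates of `ctilde`, and `C(z) C̃(z) = 1` collapses the sum. This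
makes pairing with `A_k` local, as used in `bichar_alpha_left`. -/
theorem nu_sub_one_add_nu_add_one (d : ℤ) :
    nu (d - 1) + nu (d + 1) = (if d = -1 then 1 else 0) - if d = 1 then 1 else 0 := by
  have h1 := ctilde_spec (d + 1)
  have h2 := ctilde_spec (d - 1)
  unfold nu
  simp only [sub_add_cancel, add_sub_cancel_right, sub_sub, add_assoc] at h1 h2 ⊢
  simp only [show d + 1 = 0 ↔ d = -1 by omega, show d - 1 = 0 ↔ d = 1 by omega] at h1 h2
  norm_num at h1 h2 ⊢
  omega

theorem bichar_single_left (l n : ℤ) (v : ℤ →₀ ℤ) :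
    bichar (Finsupp.single l n) v = v.sum fun k b => n * b * nu (l - k) := by
  unfold bichar
  rw [Finsupp.sum_single_index]
  simp

theorem bichar_single_single (l n k b : ℤ) :
    bichar (Finsupp.single l n) (Finsupp.single k b) = n * b * nu (l - k) := by
  rw [bichar_single_left, Finsupp.sum_single_index]
  simp

theorem bichar_neg_right (u v : ℤ →₀ ℤ) : bichar u (-v) = -bichar u v := by
  have h := bichar_add_right u (-v) v
  rw [neg_add_cancel, bichar_zero_right] at h
  omega

theorem bichar_sub_left (u u' v : ℤ →₀ ℤ) : bichar (u - u') v = bichar u v - bichar u' v := by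
  rw [sub_eq_add_neg, bichar_add_left, bichar_neg_left, sub_eq_add_neg]

theorem bichar_sub_right (u v v' : ℤ →₀ ℤ) : bichar u (v - v') = bichar u v - bichar u v' := by
  rw [sub_eq_add_neg, bichar_add_right, bichar_neg_right, sub_eq_add_neg]

theorem bichar_alpha_left (k : ℤ) (v : ℤ →₀ ℤ) :
    bichar (YMon.alpha k) v = v (k + 1) - v (k - 1) := by
  induction v using Finsupp.induction_linear with
  | zero => simp [bichar_zero_right]
  | add f g hf hg => rw [bichar_add_right, hf, hg]; simp only [Finsupp.add_apply]; ring
  | single l n =>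
    have h := nu_sub_one_add_nu_add_one (k - l)
    rw [YMon.alpha, bichar_add_left, bichar_single_single, bichar_single_single,
      show k - 1 - l = k - l - 1 by ring, show k + 1 - l = k - l + 1 by ring,
      ← mul_add, h, one_mul, Finsupp.single_apply, Finsupp.single_apply]
    simp only [show k - l = -1 ↔ l = k + 1 by omega, show k - l = 1 ↔ l = k - 1 by omega]
    split_ifs <;> ring

theorem bichar_alpha_right (k : ℤ) (v : ℤ →₀ ℤ) :
    bichar v (YMon.alpha k) = v (k - 1) - v (k + 1) := by
  induction v using Finsupp.induction_linear with
  | zero => simp [bichar_zero_left]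
  | add f g hf hg => rw [bichar_add_left, hf, hg]; simp only [Finsupp.add_apply]; ring
  | single l n =>
    have h := nu_sub_one_add_nu_add_one (l - k)
    rw [YMon.alpha, bichar_add_right, bichar_single_single, bichar_single_single,
      show l - (k - 1) = l - k + 1 by ring, show l - (k + 1) = l - k - 1 by ring,
      add_comm, ← mul_add, h, mul_one, Finsupp.single_apply, Finsupp.single_apply]
    simp only [show l - k = -1 ↔ l = k - 1 by omega, show l - k = 1 ↔ l = k + 1 by omega]
    split_ifs <;> ring

theorem alpha_apply (k l : ℤ) :
    YMon.alpha k l = (if k - 1 = l then 1 else 0) + if k + 1 = l then 1 else 0 := by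
  simp only [YMon.alpha, Finsupp.add_apply, Finsupp.single_apply]

/-- The nonempty sums of the exponent vectors `alpha l`. -/
noncomputable def posCone : AddSubsemigroup (ℤ →₀ ℤ) := AddSubsemigroup.closure (Set.range YMon.alpha)

/-- The sum of the exponents. -/
noncomputable def deg : (ℤ →₀ ℤ) →+ ℤ := Finsupp.liftAddHom fun _ : ℤ => AddMonoidHom.id ℤ

theorem deg_single (l n : ℤ) : deg (Finsupp.single l n) = n := by
  simp [deg]

theorem deg_alpha (k : ℤ) : deg (YMon.alpha k) = 2 := by
  rw [YMon.alpha, map_add, deg_single, deg_single]; rfl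

theorem deg_nonneg {u : ℤ →₀ ℤ} (h : ∀ l, 0 ≤ u l) : 0 ≤ deg u := by
  rw [deg, Finsupp.liftAddHom_apply]
  exact Finset.sum_nonneg fun l _ => h l

theorem alpha_mem_posCone (k : ℤ) : YMon.alpha k ∈ posCone :=
  AddSubsemigroup.subset_closure ⟨k, rfl⟩

theorem deg_pos {q : ℤ →₀ ℤ} (h : q ∈ posCone) : 0 < deg q := by
  induction h using AddSubsemigroup.closure_induction with
  | mem x hx => obtain ⟨k, rfl⟩ := hx; rw [deg_alpha]; decide
  | add x y _ _ hx hy => rw [map_add]; omega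

theorem ne_zero_of_mem_posCone {q : ℤ →₀ ℤ} (h : q ∈ posCone) : q ≠ 0 := by
  rintro rfl
  simpa using deg_pos h

theorem bichar_comm_of_mem_posCone {q : ℤ →₀ ℤ} (h : q ∈ posCone) (v : ℤ →₀ ℤ) :
    bichar v q = -bichar q v := by
  induction h using AddSubsemigroup.closure_induction with
  | mem x hx =>
    obtain ⟨k, rfl⟩ := hx
    rw [bichar_alpha_left, bichar_alpha_right]; ring
  | add x y _ _ hx hy => rw [bichar_add_left, bichar_add_right, hx, hy]; ring

/-- Pairing with the cone is antisymmetric, so the cross terms cancel and `bichar q q = 0`. Hence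
the correction term in `YMon.bar` is constant along the order. -/
theorem bichar_self_eq_of_sub_mem {u v : ℤ →₀ ℤ} (h : u - v ∈ posCone) :
    bichar v v = bichar u u := by
  obtain ⟨q, rfl⟩ : ∃ q, v = u - q := ⟨u - v, by abel⟩
  rw [sub_sub_cancel] at h
  have h1 := bichar_comm_of_mem_posCone h u
  have h2 := bichar_comm_of_mem_posCone h q
  rw [bichar_sub_left, bichar_sub_right, bichar_sub_right]
  omega

/-! ### Monomials and the order on dominant monomials. -/

namespace YMon

theorem one_a : (1 : YMon).a = 0 := rfl

theorem one_u : (1 : YMon).u = 0 := rfl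

theorem inv_a (g : YMon) : (g⁻¹).a = -g.a + bichar g.u g.u := rfl

theorem inv_u (g : YMon) : (g⁻¹).u = -g.u := rfl

theorem t_mul (n : ℤ) (g : YMon) : t n * g = ⟨n + g.a, g.u⟩ := by
  refine YMon.ext ?_ (zero_add _)
  change n + g.a + bichar 0 g.u = n + g.a
  rw [bichar_zero_left, add_zero]

theorem t_comm (n : ℤ) (g : YMon) : t n * g = g * t n := by
  refine YMon.ext ?_ ?_
  · simp only [mul_a, t, bichar_zero_left, bichar_zero_right]; ring
  · simp only [mul_u, t, zero_add, add_zero]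

theorem t_add (m n : ℤ) : t (m + n) = t m * t n := by
  rw [t_mul]; rfl

theorem t_zero : t 0 = 1 := rfl

theorem bar_mul_inv (g : YMon) : bar g * g⁻¹ = t (-2 * g.a + bichar g.u g.u) := by
  refine YMon.ext ?_ ?_
  · simp only [mul_a, bar, inv_a, inv_u, bichar_neg_right, t]; ring
  · simp only [mul_u, bar, inv_u, t, add_neg_cancel]

theorem bar_bar (g : YMon) : bar (bar g) = g := by
  refine YMon.ext ?_ rfl
  change -(-g.a + bichar g.u g.u) + bichar g.u g.u = g.a
  ring

theorem isAProd_neg_of_mem {q : ℤ →₀ ℤ} (h : q ∈ posCone) : ∃ R, 1 ≤ R ∧ IsAProd R (-q) := by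
  induction h using AddSubsemigroup.closure_induction with
  | mem x hx =>
    obtain ⟨k, rfl⟩ := hx
    exact ⟨1, le_rfl, fun _ => k, by simp⟩
  | add x y _ _ hx hy =>
    obtain ⟨R, hR, i, hi⟩ := hx
    obtain ⟨S, hS, j, hj⟩ := hy
    refine ⟨R + S, by omega, Fin.append i j, ?_⟩
    rw [neg_add, hi, hj, Fin.sum_univ_add]
    simp only [Fin.append_left, Fin.append_right]
    abel

theorem mem_posCone_of_isAProd {R : ℕ} {w : ℤ →₀ ℤ} (h : IsAProd R w) (hw : w ≠ 0) :
    -w ∈ posCone := by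
  obtain ⟨i, rfl⟩ := h
  rw [neg_neg]
  have key : ∀ (n : ℕ) (i : Fin (n + 1) → ℤ), ∑ j, alpha (i j) ∈ posCone := by
    intro n
    induction n with
    | zero => intro i; simpa using alpha_mem_posCone _
    | succ n ih =>
      intro i
      rw [Fin.sum_univ_succ]
      exact add_mem (alpha_mem_posCone _) (ih _)
  cases R with
  | zero => simp at hw
  | succ n => exact key n i

theorem exists_mem_AMonomials {q : ℤ →₀ ℤ} (h : q ∈ posCone) : ∃ x ∈ AMonomials, x.u = -q := by
  induction h using AddSubsemigroup.closure_induction with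
  | mem x hx =>
    obtain ⟨k, rfl⟩ := hx
    exact ⟨(A k)⁻¹, Submonoid.subset_closure ⟨k, rfl⟩, rfl⟩
  | add x y _ _ hx hy =>
    obtain ⟨g, hg, hgx⟩ := hx
    obtain ⟨h, hh, hhy⟩ := hy
    exact ⟨g * h, mul_mem hg hh, by rw [mul_u, hgx, hhy, neg_add]⟩

end YMon

theorem mul_inv_u (m' m : YMon) : (m' * m⁻¹).u = -(m.u - m'.u) := by
  rw [YMon.mul_u, YMon.inv_u]; abel

/-- The condition defining `AInv` fixes `2 a - bichar u u`. Since `bichar u u` does not change along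
the cone, it fixes the normally ordered exponent `a` itself. -/
theorem mem_lower_iff (m m' : DomMon) :
    m' ∈ lower m ↔ m'.1.a = m.1.a ∧ m.1.u - m'.1.u ∈ posCone := by
  constructor
  · rintro ⟨⟨x, -, α, h1, h2⟩, hne, R, hR⟩
    have hq : m.1.u - m'.1.u ∈ posCone := by
      have := YMon.mem_posCone_of_isAProd hR (by
        rw [mul_inv_u, neg_sub]; exact sub_ne_zero.2 hne)
      rwa [mul_inv_u, neg_neg] at this
    refine ⟨?_, hq⟩
    have e1 := congrArg YMon.a h1
    have e2 := congrArg YMon.a h2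
    have e3 := bichar_self_eq_of_sub_mem hq
    simp only [YMon.mul_a, YMon.mul_u, YMon.t, YMon.bar, bichar_zero_left, zero_add] at e1 e2
    omega
  · rintro ⟨ha, hq⟩
    have e3 := bichar_self_eq_of_sub_mem hq
    refine ⟨?_, ?_, ?_⟩
    · obtain ⟨x, hx, hxu⟩ := YMon.exists_mem_AMonomials hq
      have hu : m'.1.u = m.1.u + x.u := by rw [hxu]; abel
      refine ⟨x, hx, m'.1.a - (m.1 * x).a, ?_, ?_⟩
      · rw [mul_assoc, YMon.t_mul]
        exact YMon.ext (by simp) hu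
      · rw [mul_assoc, YMon.t_mul]
        refine YMon.ext ?_ hu
        simp only [YMon.mul_a, YMon.bar]
        omega
    · intro h
      rw [h, sub_self] at hq
      exact ne_zero_of_mem_posCone hq rfl
    · obtain ⟨R, -, hR⟩ := YMon.isAProd_neg_of_mem hq
      exact ⟨R, by rwa [mul_inv_u]⟩

theorem mem_lower_trans {m m' m'' : DomMon} (h : m' ∈ lower m) (h' : m'' ∈ lower m') :
    m'' ∈ lower m := by
  rw [mem_lower_iff] at *
  refine ⟨h'.1.trans h.1, ?_⟩
  have := add_mem h.2 h'.2
  rwa [sub_add_sub_cancel] at this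

/-- The sum of the exponents of a dominant monomial. -/
noncomputable def domDeg (m : DomMon) : ℕ := (deg m.1.u).toNat

theorem domDeg_cast (m : DomMon) : (domDeg m : ℤ) = deg m.1.u :=
  Int.toNat_of_nonneg (deg_nonneg m.2)

theorem domDeg_lt_of_sub_mem {m m' : DomMon} (h : m.1.u - m'.1.u ∈ posCone) :
    domDeg m' < domDeg m := by
  have h1 := deg_pos h
  rw [map_sub, ← domDeg_cast, ← domDeg_cast] at h1
  omega

theorem domDeg_lt {m m' : DomMon} (h : m' ∈ lower m) : domDeg m' < domDeg m :=
  domDeg_lt_of_sub_mem ((mem_lower_iff m m').1 h).2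

/-! ### Monomials and scalars inside `𝒴_t`. -/

theorem mon_mul (g h : YMon) : mon g * mon h = mon (g * h) := by
  simp [mon]

theorem mon_one : mon 1 = 1 := rfl

theorem mon_coeff (g h : YMon) [Decidable (g = h)] :
    (mon g).coeff h = if g = h then 1 else 0 := by
  rw [mon, MonoidAlgebra.coeff_single, Finsupp.single_apply]

theorem coeff_mon_t_mul (n : ℤ) (x : Yt) (g : YMon) :
    (mon (YMon.t n) * x).coeff g = x.coeff (YMon.t (-n) * g) := by
  rw [mon, MonoidAlgebra.coeff_single_mul_eq_mul_coeff (YMon.t (-n) * g), one_mul]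
  intro h _
  constructor
  · rintro rfl
    rw [← mul_assoc, ← YMon.t_add, neg_add_cancel, YMon.t_zero, one_mul]
  · rintro rfl
    rw [← mul_assoc, ← YMon.t_add, add_neg_cancel, YMon.t_zero, one_mul]

/-- The inclusion of the scalars, as a ring homomorphism. -/
noncomputable def scalarHom : ℤ[T;T⁻¹] →+* Yt :=
  (AddMonoidAlgebra.lift ℤ Yt ℤ
    { toFun := fun n => mon (YMon.t n.toAdd)
      map_one' := rfl
      map_mul' := fun m n => by rw [mon_mul, ← YMon.t_add]; rfl }).toRingHom

theorem scalarHom_apply (p : ℤ[T;T⁻¹]) : scalarHom p = scalar p := by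
  change AddMonoidAlgebra.lift ℤ Yt ℤ _ p = _
  rw [AddMonoidAlgebra.lift_apply]
  unfold scalar
  congr 1
  funext n c
  simp [mon]

theorem scalar_add (p q : ℤ[T;T⁻¹]) : scalar (p + q) = scalar p + scalar q := by
  simp only [← scalarHom_apply, map_add]

theorem scalar_sub (p q : ℤ[T;T⁻¹]) : scalar (p - q) = scalar p - scalar q := by
  simp only [← scalarHom_apply, map_sub]

theorem scalar_neg (p : ℤ[T;T⁻¹]) : scalar (-p) = -scalar p := by
  simp only [← scalarHom_apply, map_neg]

theorem scalar_mul (p q : ℤ[T;T⁻¹]) : scalar (p * q) = scalar p * scalar q := by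
  simp only [← scalarHom_apply, map_mul]

theorem scalar_zero : scalar 0 = 0 := by
  simp only [← scalarHom_apply, map_zero]

theorem scalar_one : scalar 1 = 1 := by
  simp only [← scalarHom_apply, map_one]

theorem scalar_single (n c : ℤ) :
    scalar (AddMonoidAlgebra.single n c) = MonoidAlgebra.single (YMon.t n) c := by
  rw [scalar, AddMonoidAlgebra.coeff_single]
  exact Finsupp.sum_single_index (MonoidAlgebra.single_zero _)

theorem scalar_T (n : ℤ) : scalar (LaurentPolynomial.T n) = mon (YMon.t n) :=
  scalar_single n 1

theorem scalar_commute (p : ℤ[T;T⁻¹]) (x : Yt) : scalar p * x = x * scalar p := by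
  induction p using AddMonoidAlgebra.induction_linear with
  | zero => rw [scalar_zero, zero_mul, mul_zero]
  | add p q hp hq => rw [scalar_add, add_mul, mul_add, hp, hq]
  | single n c =>
    rw [scalar_single]
    exact (MonoidAlgebra.single_commute (fun g => YMon.t_comm n g) (fun r => Commute.all c r) x).eq

theorem t_two_sub_one_mul_scalar_tnum (n : ℤ) :
    (mon (YMon.t 2) - 1) * scalar (tnum n) = mon (YMon.t (2 * n)) - 1 := by
  rw [← scalar_T, ← scalar_T, ← scalar_one, ← scalar_sub, ← scalar_mul, tnum_spec, scalar_sub]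

/-! ### The screening module is free on `S̃_0` and `S̃_1`. -/

theorem int_induction_iff {P : ℤ → Prop} (h0 : P 0) (h : ∀ k, P k ↔ P (k + 1)) (k : ℤ) : P k := by
  induction k with
  | zero => exact h0
  | succ n hn => exact (h n).1 hn
  | pred n hn =>
    refine (h _).2 ?_
    rwa [sub_add_cancel]

/-- The monomial `g` with `S̃_{p+2k} = g S̃_p`. -/
noncomputable def sRatio (p k : ℤ) : YMon :=
  Int.inductionOn' (motive := fun _ => YMon) k 0 1
    (fun k _ g => YMon.t 1 * YMon.A (p + 2 * k + 1) * g)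
    (fun k _ g => (YMon.t 1 * YMon.A (p + 2 * (k - 1) + 1))⁻¹ * g)

theorem sRatio_zero (p : ℤ) : sRatio p 0 = 1 := Int.inductionOn'_self

theorem sRatio_add_one (p k : ℤ) :
    sRatio p (k + 1) = YMon.t 1 * YMon.A (p + 2 * k + 1) * sRatio p k := by
  rcases le_or_gt 0 k with h | h
  · exact Int.inductionOn'_add_one h
  · have h1 : sRatio p (k + 1 - 1) = _ := Int.inductionOn'_sub_one (by omega : k + 1 ≤ 0)
    rw [add_sub_cancel_right] at h1
    rw [h1, mul_inv_cancel_left]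
    rfl

theorem sRatio_add_one_u (p k : ℤ) :
    (sRatio p (k + 1)).u = YMon.alpha (p + 2 * k + 1) + (sRatio p k).u := by
  rw [sRatio_add_one, YMon.mul_u, YMon.mul_u, YMon.t, zero_add]
  rfl

theorem sRatio_add_one_a (p k : ℤ) : (sRatio p (k + 1)).a =
    1 + (sRatio p k).a + ((sRatio p k).u (p + 2 * k + 2) - (sRatio p k).u (p + 2 * k)) := by
  rw [sRatio_add_one, mul_assoc, YMon.t_mul]
  change 1 + (0 + (sRatio p k).a + bichar (YMon.alpha _) (sRatio p k).u) = _
  rw [bichar_alpha_left, show p + 2 * k + 1 + 1 = p + 2 * k + 2 by ring,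
    show p + 2 * k + 1 - 1 = p + 2 * k by ring]
  ring

/-- The pairings with successive `A`'s telescope. This is what makes the rules `S̃_l m = t^{2
u_l(m)} m S̃_l` for `l = p` and `l = p + 2k` compatible. -/
theorem sRatio_bichar (p k : ℤ) (v : ℤ →₀ ℤ) :
    bichar (sRatio p k).u v - bichar v (sRatio p k).u = 2 * (v (p + 2 * k) - v p) := by
  induction k using int_induction_iff with
  | h0 => simp [sRatio_zero, YMon.one_u, bichar_zero_left, bichar_zero_right]
  | h k =>
    rw [sRatio_add_one_u, bichar_add_left, bichar_add_right, bichar_alpha_left,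
      bichar_alpha_right, show p + 2 * k + 1 - 1 = p + 2 * k by ring,
      show p + 2 * (k + 1) = p + 2 * k + 1 + 1 by ring]
    constructor <;> intro h <;> linarith

/-- For `k > 0` the exponents of `A_{p+1} A_{p+3} ⋯ A_{p+2k-1}` are `1` at both ends and `2` in
between. Writing them as a difference of two step functions also covers `k ≤ 0`. -/
theorem sRatio_u_apply (p k j : ℤ) : (sRatio p k).u (p + 2 * j) =
    ((if j = k then 1 else 0) + if j < k then 2 else 0) -
      ((if j = 0 then 1 else 0) + if j < 0 then 2 else 0) := by
  induction k using int_induction_iff with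
  | h0 => simp [sRatio_zero, YMon.one_u]
  | h k =>
    rw [sRatio_add_one_u, Finsupp.add_apply, alpha_apply]
    simp only [show p + 2 * k + 1 - 1 = p + 2 * j ↔ j = k by omega,
      show p + 2 * k + 1 + 1 = p + 2 * j ↔ j = k + 1 by omega,
      show j < k + 1 ↔ j < k ∨ j = k by omega]
    split_ifs <;> omega

theorem sRatio_u_apply_of_odd (p k q : ℤ) (hq : (q - p) % 2 = 1) : (sRatio p k).u q = 0 := by
  induction k using int_induction_iff with
  | h0 => simp [sRatio_zero, YMon.one_u]
  | h k =>
    rw [sRatio_add_one_u, Finsupp.add_apply, alpha_apply, if_neg (by omega), if_neg (by omega)]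
    simp

/-- Equivalent to `sRatio p k` being fixed by bar followed by `twistMon p`, which is how it enters
`InKt.bar`. -/
theorem sRatio_weight (p k : ℤ) :
    2 * (sRatio p k).a - bichar (sRatio p k).u (sRatio p k).u = 2 * (sRatio p k).u p := by
  induction k using int_induction_iff with
  | h0 => simp [sRatio_zero, YMon.one_u, YMon.one_a, bichar_zero_left]
  | h k =>
    have h1 := sRatio_u_apply p k k
    have h2 := sRatio_u_apply p k (k + 1)
    have h3 := sRatio_bichar p k (YMon.alpha (p + 2 * k + 1))
    rw [bichar_alpha_left, bichar_alpha_right] at h3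
    rw [sRatio_add_one_u, sRatio_add_one_a, bichar_add_left, bichar_add_right, bichar_add_right,
      bichar_alpha_left, bichar_alpha_left, bichar_alpha_right]
    simp only [show p + 2 * k + 1 - 1 = p + 2 * k by ring,
      show p + 2 * k + 1 + 1 = p + 2 * (k + 1) by ring, Finsupp.add_apply, alpha_apply,
      show p + 2 * k + 2 = p + 2 * (k + 1) by ring] at h3 ⊢
    rw [h1, h2]
    simp only [show p + 2 * k = p ↔ k = 0 by omega, show p + 2 * (k + 1) = p ↔ k = -1 by omega,
      show k + 1 = 0 ↔ k = -1 by omega]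
    split_ifs <;> omega

/-- The automorphism `m ↦ t^{2 u_p(m)} m`, so that `S̃_p m = twistMon p m S̃_p`. -/
def twistMon (p : ℤ) : YMon →* YMon where
  toFun g := ⟨2 * g.u p + g.a, g.u⟩
  map_one' := by ext <;> simp [YMon.one_a, YMon.one_u]
  map_mul' g h := by
    refine YMon.ext ?_ rfl
    simp only [YMon.mul_a, YMon.mul_u, Finsupp.add_apply]
    ring

theorem sRatio_mul_twistMon (p k : ℤ) (g : YMon) :
    sRatio p k * twistMon p g = YMon.t (2 * g.u (p + 2 * k)) * (g * sRatio p k) := by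
  have h := sRatio_bichar p k g.u
  rw [YMon.t_mul]
  refine YMon.ext ?_ (add_comm _ _)
  change (sRatio p k).a + (2 * g.u p + g.a) + bichar (sRatio p k).u g.u =
    2 * g.u (p + 2 * k) + (g.a + (sRatio p k).a + bichar g.u (sRatio p k).u)
  linarith

/-- The automorphism `twistMon p`, extended to `𝒴_t`. -/
noncomputable def twist (p : ℤ) : Yt →+* Yt := MonoidAlgebra.mapDomainRingHom ℤ (twistMon p)

theorem twist_single (p : ℤ) (g : YMon) (c : ℤ) :
    twist p (MonoidAlgebra.single g c) = MonoidAlgebra.single (twistMon p g) c :=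
  MonoidAlgebra.mapDomain_single

/-- `x ↦ [S̃_{p+2k}, x]`, as a multiple of `S̃_p`. -/
noncomputable def comm (p k : ℤ) : Yt →+ Yt :=
  (AddMonoidHom.mulLeft (mon (sRatio p k))).comp (twist p).toAddMonoidHom -
    AddMonoidHom.mulRight (mon (sRatio p k))

theorem comm_apply (p k : ℤ) (x : Yt) :
    comm p k x = mon (sRatio p k) * twist p x - x * mon (sRatio p k) := rfl

theorem comm_single (p k : ℤ) (g : YMon) (c : ℤ) :
    comm p k (MonoidAlgebra.single g c) =
      MonoidAlgebra.single (YMon.t (2 * g.u (p + 2 * k)) * (g * sRatio p k)) c -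
        MonoidAlgebra.single (g * sRatio p k) c := by
  rw [comm_apply, twist_single, mon, MonoidAlgebra.single_mul_single,
    MonoidAlgebra.single_mul_single, sRatio_mul_twistMon, one_mul, mul_one]

theorem comm_single' (p k : ℤ) (g : YMon) (c : ℤ) :
    comm p k (MonoidAlgebra.single g c) =
      c • ((mon (YMon.t (2 * g.u (p + 2 * k))) - 1) * mon g * mon (sRatio p k)) := by
  rw [comm_single, mul_assoc, mon_mul, sub_mul, one_mul, mon_mul, smul_sub]
  simp [mon]

theorem comm_eq_zero (p k : ℤ) (x : Yt) (h : ∀ g ∈ x.coeff.support, g.u (p + 2 * k) = 0) :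
    comm p k x = 0 := by
  rw [← MonoidAlgebra.sum_coeff_single x, Finsupp.sum, map_sum]
  refine Finset.sum_eq_zero fun g hg => ?_
  rw [comm_single, h g hg, mul_zero, YMon.t_zero, one_mul, sub_self]

/-- The image of `S̃_l` under `phi p`. -/
noncomputable def phiGen (p l : ℤ) : Yt :=
  if (l - p) % 2 = 0 then mon (sRatio p ((l - p) / 2)) else 0

theorem phiGen_apply (p k : ℤ) : phiGen p (p + 2 * k) = mon (sRatio p k) := by
  rw [phiGen, if_pos (by omega), show (p + 2 * k - p) / 2 = k by omega]

theorem phiGen_rel (p l : ℤ) :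
    mon (YMon.A l) * phiGen p (l - 1) = mon (YMon.t (-1)) * phiGen p (l + 1) := by
  by_cases h : (l - 1 - p) % 2 = 0
  · obtain ⟨k, hk⟩ : ∃ k, l = p + 2 * k + 1 := ⟨(l - 1 - p) / 2, by omega⟩
    subst hk
    rw [show p + 2 * k + 1 - 1 = p + 2 * k by ring,
      show p + 2 * k + 1 + 1 = p + 2 * (k + 1) by ring, phiGen_apply, phiGen_apply,
      sRatio_add_one, mon_mul, mon_mul, ← mul_assoc, ← mul_assoc, ← YMon.t_add]
    simp [YMon.t_zero]
  · rw [phiGen, phiGen, if_neg h, if_neg (by omega), mul_zero, mul_zero]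

/-- The coordinate of the screening module along `S̃_p`. -/
noncomputable def phi (p : ℤ) : ScreenMod →ₗ[Yt] Yt :=
  Submodule.liftQ _ (Finsupp.linearCombination Yt (phiGen p)) (by
    rw [Submodule.span_le]
    rintro _ ⟨l, rfl⟩
    rw [SetLike.mem_coe, LinearMap.mem_ker, map_sub, Finsupp.linearCombination_single,
      Finsupp.linearCombination_single, smul_eq_mul, smul_eq_mul, phiGen_rel, sub_self])

theorem phi_S (p l : ℤ) : phi p (S l) = phiGen p l := by
  rw [S, phi, Submodule.liftQ_apply, Finsupp.linearCombination_single, one_smul]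

theorem S_rel (l : ℤ) : mon (YMon.A l) • S (l - 1) = mon (YMon.t (-1)) • S (l + 1) := by
  rw [S, S, ← Submodule.Quotient.mk_smul, ← Submodule.Quotient.mk_smul,
    Submodule.Quotient.eq, Finsupp.smul_single, Finsupp.smul_single, smul_eq_mul, smul_eq_mul,
    mul_one, mul_one]
  exact Submodule.subset_span ⟨l, rfl⟩

theorem S_add_one (l : ℤ) : S (l + 1) = mon (YMon.t 1 * YMon.A l) • S (l - 1) := by
  rw [← mon_mul, mul_smul, S_rel, ← mul_smul, mon_mul, ← YMon.t_add]
  simp [YMon.t_zero, mon_one]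

theorem S_eq (p k : ℤ) : S (p + 2 * k) = mon (sRatio p k) • S p := by
  induction k using int_induction_iff with
  | h0 => rw [mul_zero, add_zero, sRatio_zero, mon_one, one_smul]
  | h k =>
    have h1 := S_add_one (p + 2 * k + 1)
    rw [show p + 2 * k + 1 + 1 = p + 2 * (k + 1) by ring,
      show p + 2 * k + 1 - 1 = p + 2 * k by ring] at h1
    rw [h1, sRatio_add_one, ← mon_mul _ (sRatio p k), mul_smul]
    refine ⟨fun h => by rw [h], fun h => ?_⟩
    have h2 := congrArg (fun z => mon ((YMon.t 1 * YMon.A (p + 2 * k + 1))⁻¹) • z) h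
    simpa only [← mul_smul, mon_mul, inv_mul_cancel, mon_one, one_smul, inv_mul_cancel_left]
      using h2

theorem exists_eq_smul_add_smul (z : ScreenMod) : ∃ a b : Yt, z = a • S 0 + b • S 1 := by
  obtain ⟨f, rfl⟩ := Submodule.Quotient.mk_surjective _ z
  induction f using Finsupp.induction_linear with
  | zero => exact ⟨0, 0, by simp⟩
  | add f g hf hg =>
    obtain ⟨a, b, h⟩ := hf
    obtain ⟨c, d, h'⟩ := hg
    refine ⟨a + c, b + d, ?_⟩
    rw [Submodule.Quotient.mk_add, h, h', add_smul, add_smul]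
    abel
  | single l x =>
    have h : (Submodule.Quotient.mk (Finsupp.single l x) : ScreenMod) = x • S l := by
      rw [S, ← Submodule.Quotient.mk_smul, Finsupp.smul_single, smul_eq_mul, mul_one]
    rw [h]
    rcases Int.emod_two_eq_zero_or_one l with h0 | h1
    · refine ⟨x * mon (sRatio 0 (l / 2)), 0, ?_⟩
      rw [mul_smul, ← S_eq, zero_smul, add_zero, show 0 + 2 * (l / 2) = l by omega]
    · refine ⟨0, x * mon (sRatio 1 (l / 2)), ?_⟩
      rw [mul_smul, ← S_eq, zero_smul, zero_add, show 1 + 2 * (l / 2) = l by omega]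

/-- The relations link only indices of equal parity, so `S̃_0` and `S̃_1` span, and `phi 0`, `phi 1`
read off their coefficients. -/
theorem eq_zero_of_phi_eq_zero {z : ScreenMod} (h0 : phi 0 z = 0) (h1 : phi 1 z = 0) : z = 0 := by
  obtain ⟨a, b, rfl⟩ := exists_eq_smul_add_smul z
  simp only [map_add, map_smul, phi_S, smul_eq_mul] at h0 h1
  have e : ∀ p, phiGen p p = 1 := fun p => by
    have := phiGen_apply p 0
    rwa [mul_zero, add_zero, sRatio_zero, mon_one] at this
  rw [e, phiGen, if_neg (by decide), mul_zero, add_zero, mul_one] at h0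
  rw [e, phiGen, if_neg (by decide), mul_zero, zero_add, mul_one] at h1
  rw [h0, h1, zero_smul, zero_smul, add_zero]

/-! ### The kernel of the screening operator as a commutation condition. -/

/-- A nonempty finite support cannot be stable under a nontrivial translation of the `t`-exponent.
Hence factors `t^n - 1` with `n ≠ 0` can be cancelled. -/
theorem eq_zero_of_mon_t_mul_eq {n : ℤ} (hn : n ≠ 0) {x : Yt} (h : mon (YMon.t n) * x = x) :
    x = 0 := by
  by_contra hx
  have hs : x.coeff.support.Nonempty := by
    rw [Finsupp.support_nonempty_iff]
    simpa using hx
  have step : ∀ g ∈ x.coeff.support, YMon.t n * g ∈ x.coeff.support ∧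
      YMon.t (-n) * g ∈ x.coeff.support := by
    intro g hg
    rw [Finsupp.mem_support_iff] at hg
    have e1 := coeff_mon_t_mul n x (YMon.t n * g)
    have e2 := coeff_mon_t_mul n x g
    rw [h, ← mul_assoc, ← YMon.t_add, neg_add_cancel, YMon.t_zero, one_mul] at e1
    rw [h] at e2
    rw [Finsupp.mem_support_iff, Finsupp.mem_support_iff, e1, ← e2]
    exact ⟨hg, hg⟩
  obtain ⟨g, hg, hmax⟩ := Finset.exists_max_image x.coeff.support YMon.a hs
  have h1 := hmax _ (step g hg).1
  have h2 := hmax _ (step g hg).2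
  rw [YMon.t_mul] at h1 h2
  simp only at h1 h2
  omega

theorem screening_add (x y : Yt) : screening (x + y) = screening x + screening y := by
  classical
  unfold screening
  rw [MonoidAlgebra.coeff_add, Finsupp.sum_add_index']
  · intro g; rw [zero_smul]
  · intro g c d; rw [add_smul]

theorem screening_zero : screening 0 = 0 := by simp [screening]

theorem screening_single (g : YMon) (c : ℤ) : screening (MonoidAlgebra.single g c) =
    c • g.u.sum fun l n => (scalar (tnum n) * mon g) • S l := by
  unfold screening
  rw [MonoidAlgebra.coeff_single, Finsupp.sum_single_index]
  rw [zero_smul]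

/-- The sum of commutators over all `k` is infinite but only finitely many terms are nonzero for a
given `x`; "for all large finite sets" replaces it and lets several such conditions be combined. -/
theorem eventually_phi_screening (p : ℤ) (x : Yt) : ∀ᶠ N : Finset ℤ in atTop,
    (mon (YMon.t 2) - 1) * phi p (screening x) = ∑ k ∈ N, comm p k x := by
  classical
  induction x using MonoidAlgebra.induction_linear with
  | zero => simp [screening_zero]
  | add x y hx hy =>
    filter_upwards [hx, hy] with N h1 h2
    rw [screening_add, map_add, mul_add, h1, h2, ← Finset.sum_add_distrib]
    simp only [map_add]
  | single g c =>
    filter_upwards [eventually_ge_atTop (g.u.support.image fun l => (l - p) / 2)] with N hN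
    let f : ℤ → Yt := fun l => (mon (YMon.t (2 * g.u l)) - 1) * mon g * phiGen p l
    have h1 : (mon (YMon.t 2) - 1) * phi p (screening (MonoidAlgebra.single g c)) =
        c • ∑ l ∈ g.u.support, f l := by
      rw [screening_single, map_zsmul, mul_smul_comm, Finsupp.sum, map_sum, Finset.mul_sum]
      congr 1
      refine Finset.sum_congr rfl fun l _ => ?_
      rw [map_smul, phi_S, smul_eq_mul, ← mul_assoc, ← mul_assoc, t_two_sub_one_mul_scalar_tnum]
    have h2 : ∑ k ∈ N, comm p k (MonoidAlgebra.single g c) =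
        c • ∑ l ∈ N.image (fun k => p + 2 * k), f l := by
      rw [Finset.sum_image (fun a _ b _ h => by simpa using h), Finset.smul_sum]
      refine Finset.sum_congr rfl fun k _ => ?_
      rw [comm_single']
      simp only [f, phiGen_apply]
    rw [h1, h2]
    congr 1
    -- An index in only one of the two sets contributes nothing: either its exponent in `g` is `0`,
    -- or it has the wrong parity and `phiGen` vanishes.
    refine Finset.sum_congr_of_eq_on_inter ?_ ?_ fun _ _ _ => rfl
    · intro l hs hl
      by_cases hp : (l - p) % 2 = 0
      · have : g.u l = 0 := by
          by_contra h0
          refine hl (Finset.mem_image.2 ⟨(l - p) / 2, hN (Finset.mem_image.2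
            ⟨l, Finsupp.mem_support_iff.2 h0, rfl⟩), by omega⟩)
        simp only [f, this, mul_zero, YMon.t_zero, mon_one, sub_self, zero_mul]
      · simp only [f, phiGen, if_neg hp, mul_zero]
    · intro l _ hl
      rw [Finsupp.notMem_support_iff] at hl
      simp only [f, hl, mul_zero, YMon.t_zero, mon_one, sub_self, zero_mul]

theorem inKt_iff (x : Yt) :
    InKt x ↔ ∀ p, ∀ᶠ N : Finset ℤ in atTop, ∑ k ∈ N, comm p k x = 0 := by
  constructor
  · intro h p
    filter_upwards [eventually_phi_screening p x] with N hN
    rw [← hN, show screening x = 0 from h, map_zero, mul_zero]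
  · intro h
    have key : ∀ p, phi p (screening x) = 0 := fun p => by
      obtain ⟨N, h1, h2⟩ := ((h p).and (eventually_phi_screening p x)).exists
      rw [h1, sub_mul, one_mul, sub_eq_zero] at h2
      exact eq_zero_of_mon_t_mul_eq two_ne_zero h2
    exact eq_zero_of_phi_eq_zero (key 0) (key 1)

/-- The sum of the `S̃_{p+2k}`, `k ∈ N`, as a multiple of `S̃_p`. -/
noncomputable def sSum (p : ℤ) (N : Finset ℤ) : Yt := ∑ k ∈ N, mon (sRatio p k)

theorem sum_comm (p : ℤ) (N : Finset ℤ) (x : Yt) :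
    ∑ k ∈ N, comm p k x = sSum p N * twist p x - x * sSum p N := by
  simp only [comm_apply, Finset.sum_sub_distrib, sSum, Finset.sum_mul, Finset.mul_sum]

theorem inKt_iff_sSum (x : Yt) : InKt x ↔
    ∀ p, ∀ᶠ N : Finset ℤ in atTop, sSum p N * twist p x = x * sSum p N := by
  simp only [inKt_iff, sum_comm, sub_eq_zero]

theorem InKt.zero : InKt 0 := screening_zero

theorem InKt.add {x y : Yt} (hx : InKt x) (hy : InKt y) : InKt (x + y) := by
  rw [InKt, screening_add, hx, hy, add_zero]

/-- Commuting with a fixed formal element, up to the ring homomorphism `twist p`, is a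
multiplicative condition. -/
theorem InKt.mul {x y : Yt} (hx : InKt x) (hy : InKt y) : InKt (x * y) := by
  rw [inKt_iff_sSum] at *
  intro p
  filter_upwards [hx p, hy p] with N h1 h2
  rw [map_mul, ← mul_assoc, h1, mul_assoc, h2, mul_assoc]

theorem inKt_single {g : YMon} (hg : g.u = 0) (c : ℤ) : InKt (MonoidAlgebra.single g c) := by
  rw [InKt, screening_single, hg, Finsupp.sum_zero_index, smul_zero]

theorem InKt.one : InKt 1 := inKt_single YMon.one_u 1

theorem InKt.scalar (p : ℤ[T;T⁻¹]) : InKt (scalar p) := by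
  induction p using AddMonoidAlgebra.induction_linear with
  | zero => rw [scalar_zero]; exact InKt.zero
  | add p q hp hq => rw [scalar_add]; exact hp.add hq
  | single n c => rw [scalar_single]; exact inKt_single rfl c

theorem InKt.neg {x : Yt} (hx : InKt x) : InKt (-x) := by
  have h := (InKt.scalar (-1)).mul hx
  rwa [scalar_neg, scalar_one, neg_one_mul] at h

theorem InKt.sub {x y : Yt} (hx : InKt x) (hy : InKt y) : InKt (x - y) := by
  rw [sub_eq_add_neg]
  exact hx.add hy.neg

theorem InKt.sum {ι : Type*} (s : Finset ι) {f : ι → Yt} (h : ∀ i ∈ s, InKt (f i)) :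
    InKt (∑ i ∈ s, f i) :=
  Finset.sum_induction f InKt (fun _ _ => InKt.add) InKt.zero h

theorem InKt.pow {x : Yt} (hx : InKt x) (n : ℕ) : InKt (x ^ n) := by
  induction n with
  | zero => rw [pow_zero]; exact InKt.one
  | succ n ih => rw [pow_succ]; exact ih.mul hx

/-! ### The bar involution preserves the kernel. -/

theorem bar_single (g : YMon) (c : ℤ) :
    bar (MonoidAlgebra.single g c) = MonoidAlgebra.single g.bar c := MonoidAlgebra.mapDomain_single

theorem bar_add (x y : Yt) : bar (x + y) = bar x + bar y := MonoidAlgebra.mapDomain_add _ _ _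

theorem bar_zero : bar 0 = 0 := MonoidAlgebra.mapDomain_zero _

theorem bar_sum {ι : Type*} (s : Finset ι) (f : ι → Yt) :
    bar (∑ i ∈ s, f i) = ∑ i ∈ s, bar (f i) :=
  map_sum (⟨⟨bar, bar_zero⟩, bar_add⟩ : Yt →+ Yt) f s

theorem bar_sub (x y : Yt) : bar (x - y) = bar x - bar y :=
  map_sub (⟨⟨bar, bar_zero⟩, bar_add⟩ : Yt →+ Yt) x y

theorem bar_mul (x y : Yt) : bar (x * y) = bar y * bar x := by
  induction x using MonoidAlgebra.induction_linear with
  | zero => simp [bar_zero]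
  | add x x' hx hx' => rw [add_mul, bar_add, hx, hx', bar_add, mul_add]
  | single g c =>
    induction y using MonoidAlgebra.induction_linear with
    | zero => simp [bar_zero]
    | add x x' hx hx' => rw [mul_add, bar_add, hx, hx', bar_add, add_mul]
    | single h d =>
      rw [MonoidAlgebra.single_mul_single, bar_single, bar_single, bar_single,
        MonoidAlgebra.single_mul_single, YMon.bar_mul, mul_comm]

theorem coeff_bar (x : Yt) (g : YMon) : (bar x).coeff g = x.coeff g.bar := by
  have h := Finsupp.mapDomain_apply (Function.Involutive.injective YMon.bar_bar) x.coeff g.bar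
  rw [YMon.bar_bar] at h
  exact h

theorem bar_scalar (p : ℤ[T;T⁻¹]) : bar (scalar p) = scalar (LaurentPolynomial.invert p) := by
  induction p using AddMonoidAlgebra.induction_linear with
  | zero => rw [scalar_zero, bar_zero, map_zero, scalar_zero]
  | add p q hp hq => rw [scalar_add, bar_add, map_add, scalar_add, hp, hq]
  | single n c =>
    rw [scalar_single, bar_single, YMon.bar_t, LaurentPolynomial.single_eq_C_mul_T, map_mul,
      LaurentPolynomial.invert_C, LaurentPolynomial.invert_T,
      ← LaurentPolynomial.single_eq_C_mul_T, scalar_single]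

theorem twistMon_bar_sRatio (p k : ℤ) : twistMon p (sRatio p k).bar = sRatio p k := by
  have h := sRatio_weight p k
  refine YMon.ext ?_ rfl
  change 2 * (sRatio p k).u p + (-(sRatio p k).a + bichar _ _) = (sRatio p k).a
  linarith

theorem twist_bar_sSum (p : ℤ) (N : Finset ℤ) : twist p (bar (sSum p N)) = sSum p N := by
  rw [sSum, bar_sum, map_sum]
  refine Finset.sum_congr rfl fun k _ => ?_
  rw [mon, bar_single, twist_single, twistMon_bar_sRatio]

theorem twist_bar_twist (p : ℤ) (x : Yt) : twist p (bar (twist p x)) = bar x := by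
  induction x using MonoidAlgebra.induction_linear with
  | zero => simp [bar_zero]
  | add x y hx hy => rw [map_add, bar_add, map_add, hx, hy, bar_add]
  | single g c =>
    rw [twist_single, bar_single, twist_single, bar_single]
    congr 1
    refine YMon.ext ?_ rfl
    change 2 * g.u p + (-(2 * g.u p + g.a) + bichar g.u g.u) = -g.a + bichar g.u g.u
    ring

/-- The map `y ↦ twist p (bar y)` is antimultiplicative, fixes `sSum p N` and sends `twist p x` to
`bar x`, so it turns the commutation relation for `x` into the one for `bar x`. -/
theorem InKt.bar {x : Yt} (hx : InKt x) : InKt (bar x) := by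
  rw [inKt_iff_sSum] at *
  intro p
  filter_upwards [hx p] with N h
  have h1 := congrArg (fun y => twist p (QTsl2.bar y)) h
  simp only [bar_mul, map_mul, twist_bar_twist, twist_bar_sSum] at h1
  exact h1.symm

/-! ### Nonzero elements of the kernel have dominant monomials. -/

open Classical in
/-- The part of `x` consisting of the monomials `m` with `u_l(m) = n`. -/
noncomputable def part (l n : ℤ) : Yt →+ Yt where
  toFun x := MonoidAlgebra.ofCoeff (x.coeff.filter fun g => g.u l = n)
  map_zero' := congrArg MonoidAlgebra.ofCoeff (Finsupp.filter_zero _)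
  map_add' x y := by rw [MonoidAlgebra.coeff_add, Finsupp.filter_add, MonoidAlgebra.ofCoeff_add]

theorem coeff_part (l n : ℤ) (x : Yt) (g : YMon) :
    (part l n x).coeff g = if g.u l = n then x.coeff g else 0 :=
  Finsupp.filter_apply _ _ _

theorem part_single (l n : ℤ) (g : YMon) (c : ℤ) :
    part l n (MonoidAlgebra.single g c) = if g.u l = n then MonoidAlgebra.single g c else 0 := by
  classical
  ext h
  rw [coeff_part, MonoidAlgebra.coeff_single, Finsupp.single_apply]
  by_cases hg : g = h
  · subst hg
    by_cases h1 : g.u l = n <;> simp [h1]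
  · by_cases h1 : g.u l = n <;> simp [h1, hg]

theorem part_comm {p k l κ : ℤ} (h : (sRatio p k).u l = κ) (n : ℤ) (x : Yt) :
    part l (n + κ) (comm p k x) = comm p k (part l n x) := by
  induction x using MonoidAlgebra.induction_linear with
  | zero => simp only [map_zero]
  | add x y hx hy => simp only [map_add, hx, hy]
  | single g c =>
    have e : (g * sRatio p k).u l = n + κ ↔ g.u l = n := by
      rw [YMon.mul_u, Finsupp.add_apply, h, add_left_inj]
    rw [comm_single, map_sub, part_single, part_single, part_single, YMon.t_mul]
    simp only [e]
    split_ifs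
    · rw [comm_single, YMon.t_mul]
    · rw [sub_self, map_zero]

theorem part_eq_zero {l n : ℤ} {x : Yt} (h : ∀ g ∈ x.coeff.support, g.u l ≠ n) :
    part l n x = 0 := by
  ext g
  rw [coeff_part]
  split_ifs with hg
  · by_contra h0
    exact h g (Finsupp.mem_support_iff.2 h0) hg
  · rfl

theorem twist_part (l n : ℤ) (x : Yt) :
    twist l (part l n x) = mon (YMon.t (2 * n)) * part l n x := by
  induction x using MonoidAlgebra.induction_linear with
  | zero => simp only [map_zero, mul_zero]
  | add x y hx hy => simp only [map_add, hx, hy, mul_add]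
  | single g c =>
    rw [part_single]
    split_ifs with h
    · rw [twist_single, mon, MonoidAlgebra.single_mul_single, one_mul, YMon.t_mul, ← h]
      rfl
    · rw [map_zero, mul_zero]

/-- Past the index `l`, the `Ỹ_l`-degree of `sRatio p k` no longer depends on `k`, and at the index
`l` itself it is one less. So in a fixed `Ỹ_l`-degree only two adjacent parts of `x` can interact.
-/
theorem exists_sRatio_u_eq (p l : ℤ) : ∃ κ : ℤ,
    (∀ k, l < p + 2 * k → (sRatio p k).u l = κ) ∧ ∀ k, l = p + 2 * k → (sRatio p k).u l = κ - 1 := by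
  rcases Int.emod_two_eq_zero_or_one (l - p) with h | h
  · obtain ⟨j, rfl⟩ : ∃ j, l = p + 2 * j := ⟨(l - p) / 2, by omega⟩
    refine ⟨2 - ((if j = 0 then 1 else 0) + if j < 0 then 2 else 0), fun k hk => ?_, fun k hk => ?_⟩
    · rw [sRatio_u_apply, if_neg (by omega), if_pos (by omega), zero_add]
    · rw [sRatio_u_apply, if_pos (by omega), if_neg (by omega), add_zero]
      ring
  · exact ⟨0, fun k _ => sRatio_u_apply_of_odd p k l h, fun k hk => by omega⟩

/-- `x` is annihilated by the part of the screening operator with indices at least `l`. -/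
def ScreenedFrom (l : ℤ) (x : Yt) : Prop :=
  ∀ p, ∀ᶠ N : Finset ℤ in atTop, ∑ k ∈ N with l ≤ p + 2 * k, comm p k x = 0

/-- In degree `n + κ` the indices beyond `l` see the part of degree `n`, while index `l` sees only
the vanishing part of degree `n + 1`. The top part is thus screened without using index `l`. -/
theorem ScreenedFrom.part_top {l n : ℤ} {x : Yt} (h : ScreenedFrom l x)
    (hn : part l (n + 1) x = 0) : ScreenedFrom (l + 1) (part l n x) := by
  intro p
  obtain ⟨κ, h1, h2⟩ := exists_sRatio_u_eq p l
  filter_upwards [h p] with N hN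
  have h3 := congrArg (part l (n + κ)) hN
  rw [map_sum, map_zero] at h3
  rw [← h3]
  have hsub : (N.filter fun k => l + 1 ≤ p + 2 * k) ⊆ N.filter fun k => l ≤ p + 2 * k :=
    Finset.monotone_filter_right _ fun k _ hk => by omega
  rw [← Finset.sum_subset hsub]
  · refine Finset.sum_congr rfl fun k hk => ?_
    rw [part_comm (h1 k (by have := (Finset.mem_filter.1 hk).2; omega))]
  · intro k hk hk'
    rw [Finset.mem_filter] at hk hk'
    have e : l = p + 2 * k := by
      by_contra h0
      exact hk' ⟨hk.1, by omega⟩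
    have h4 := part_comm (h2 k e) (n + 1) x
    rw [hn, map_zero, show n + 1 + (κ - 1) = n + κ by ring] at h4
    exact h4

/-- With `p = l`, degree `n` receives only the vanishing part of degree `n - 1` from indices beyond
`l`, and `(t^{2n} - 1)` times the part of degree `n` from index `l`. -/
theorem ScreenedFrom.part_bot {l n : ℤ} {x : Yt} (h : ScreenedFrom l x)
    (hn : part l (n - 1) x = 0) (h0 : n ≠ 0) : part l n x = 0 := by
  obtain ⟨κ, h1, h2⟩ := exists_sRatio_u_eq l l
  have hκ : κ = 1 := by
    have := h2 0 (by ring)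
    rw [sRatio_zero, YMon.one_u, Finsupp.zero_apply] at this
    omega
  subst hκ
  obtain ⟨N, hN, hN0⟩ := ((h l).and (eventually_ge_atTop {0})).exists
  have h3 := congrArg (part l n) hN
  rw [map_sum, map_zero, Finset.sum_eq_single_of_mem 0] at h3
  · have h4 := part_comm (h2 0 (by ring)) n x
    rw [sub_self, add_zero, h3, comm_apply, sRatio_zero, mon_one, one_mul, mul_one, twist_part,
      eq_comm, sub_eq_zero] at h4
    exact eq_zero_of_mon_t_mul_eq (by omega) h4
  · exact Finset.mem_filter.2 ⟨hN0 (Finset.mem_singleton_self _), by simp⟩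
  · intro k hk hk0
    have h4 := part_comm (h1 k (by have := (Finset.mem_filter.1 hk).2; omega)) (n - 1) x
    rw [sub_add_cancel, hn, map_zero] at h4
    exact h4

/-- Descending induction on `l`. If the largest `Ỹ_l`-degree is nonnegative, pass to the top part
and use the case `l + 1`. If it is negative, so is the smallest, and `ScreenedFrom.part_bot` kills a
nonzero part. -/
theorem ScreenedFrom.exists_nonneg {L l : ℤ} (hl : l ≤ L) {x : Yt} (hx : x ≠ 0)
    (hL : ∀ g ∈ x.coeff.support, ∀ i, L ≤ i → g.u i = 0) (h : ScreenedFrom l x) :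
    ∃ g ∈ x.coeff.support, ∀ i, l ≤ i → 0 ≤ g.u i := by
  induction l, hl using Int.leInductionDown generalizing x with
  | base =>
    obtain ⟨g, hg⟩ := Finsupp.support_nonempty_iff.2 (by simpa using hx : x.coeff ≠ 0)
    exact ⟨g, hg, fun i hi => (hL g hg i hi).ge⟩
  | pred l' hl ih =>
    obtain ⟨l, rfl⟩ : ∃ l, l' = l + 1 := ⟨l' - 1, by ring⟩
    rw [add_sub_cancel_right] at h ⊢
    have hs := Finsupp.support_nonempty_iff.2 (by simpa using hx : x.coeff ≠ 0)
    obtain ⟨g, hg, hmax⟩ := Finset.exists_max_image x.coeff.support (fun g => g.u l) hs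
    rcases le_or_gt 0 (g.u l) with hd | hd
    · have hne : part l (g.u l) x ≠ 0 := by
        intro h0
        have h1 := coeff_part l (g.u l) x g
        rw [h0, if_pos rfl] at h1
        exact Finsupp.mem_support_iff.1 hg h1.symm
      have hmem : ∀ k, k ∈ (part l (g.u l) x).coeff.support →
          k ∈ x.coeff.support ∧ k.u l = g.u l := by
        intro k hk
        rw [Finsupp.mem_support_iff, coeff_part] at hk
        rw [Finsupp.mem_support_iff]
        split_ifs at hk with h1
        · exact ⟨hk, h1⟩
        · exact (hk rfl).elim
      obtain ⟨k, hk, hk'⟩ := ih hne (fun k hk => hL k (hmem k hk).1) (h.part_top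
        (part_eq_zero fun k hk => by have := hmax k hk; omega))
      refine ⟨k, (hmem k hk).1, fun i hi => ?_⟩
      rcases hi.eq_or_lt with rfl | hi
      · rw [(hmem k hk).2]; exact hd
      · exact hk' i hi
    · obtain ⟨k, hk, hmin⟩ := Finset.exists_min_image x.coeff.support (fun g => g.u l) hs
      have h1 := h.part_bot (n := k.u l)
        (part_eq_zero fun j hj => by have := hmin j hj; omega)
        (by have := hmax k hk; omega)
      have h2 := coeff_part l (k.u l) x k
      rw [h1, if_pos rfl] at h2
      exact (Finsupp.mem_support_iff.1 hk h2.symm).elim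

theorem InKt.exists_dominant {x : Yt} (h : InKt x) (hx : x ≠ 0) :
    ∃ g ∈ x.coeff.support, g.Dominant := by
  classical
  -- All exponents of `x` live strictly between `-B` and `B`, so being in the kernel is the same as
  -- being screened from `-B`.
  let s : Finset ℤ := x.coeff.support.biUnion fun g => g.u.support
  let B : ℤ := ((s.sup Int.natAbs : ℕ) : ℤ) + 1
  have hB : ∀ g ∈ x.coeff.support, ∀ i, g.u i ≠ 0 → i.natAbs < B := by
    intro g hg i hi
    have : i.natAbs ≤ s.sup Int.natAbs := Finset.le_sup
      (Finset.mem_biUnion.2 ⟨g, hg, Finsupp.mem_support_iff.2 hi⟩)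
    omega
  have hs : ScreenedFrom (-B) x := by
    intro p
    filter_upwards [(inKt_iff x).1 h p] with N hN
    rw [Finset.sum_filter_of_ne, hN]
    intro k _ hk
    by_contra hlt
    refine hk (comm_eq_zero p k x fun g hg => ?_)
    by_contra h0
    have := hB g hg _ h0
    omega
  obtain ⟨g, hg, hg'⟩ := hs.exists_nonneg (L := B) (by omega) hx fun g hg i hi => by
    by_contra h0
    have := hB g hg i h0
    omega
  refine ⟨g, hg, fun i => ?_⟩
  by_cases h0 : g.u i = 0
  · exact h0.ge
  · have := hB g hg i h0
    exact hg' i (by omega)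

theorem InKt.ext {x y : Yt} (hx : InKt x) (hy : InKt y)
    (h : ∀ g : YMon, g.Dominant → x.coeff g = y.coeff g) : x = y := by
  rw [← sub_eq_zero]
  by_contra h0
  obtain ⟨g, hg, hd⟩ := (hx.sub hy).exists_dominant h0
  rw [Finsupp.mem_support_iff, MonoidAlgebra.coeff_sub, Finsupp.sub_apply, h g hd, sub_self] at hg
  exact hg rfl

theorem IsFt.unique {m : DomMon} {x y : Yt} (hx : IsFt m x) (hy : IsFt m y) : x = y := by
  refine hx.1.ext hy.1 fun g hg => ?_
  by_cases h : g = m.1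
  · rw [h, hx.2.1, hy.2.1]
  · rw [hx.2.2 g hg h, hy.2.2 g hg h]

theorem ft_eq {m : DomMon} {x : Yt} (hx : IsFt m x) : Ft m = x :=
  (Classical.epsilon_spec (p := IsFt m) ⟨x, hx⟩).unique hx

/-! ### Fundamental elements, leading monomials and `E_t`. -/

theorem tnum_one : tnum 1 = 1 := by
  simp [tnum]

theorem tnum_neg_one : tnum (-1) = -LaurentPolynomial.T (-2) := by
  simp [tnum]

/-- `F_t(Ỹ_l) = Ỹ_l (1 + t⁻¹ Ã_{l+1}⁻¹)`. -/
noncomputable def fund (l : ℤ) : Yt :=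
  mon (YMon.Y l) + mon ⟨0, -Finsupp.single (l + 2) 1⟩

/-- The two monomials contribute opposite multiples of `S̃_l`, once `S̃_{l+2} = t Ã_{l+1} S̃_l` is
substituted. -/
theorem inKt_fund (l : ℤ) : InKt (fund l) := by
  have h1 : screening (mon (YMon.Y l)) = mon (YMon.Y l) • S l := by
    rw [mon, screening_single, one_smul, YMon.Y, Finsupp.sum_single_index, tnum_one, scalar_one,
      one_mul]
    · rfl
    · simp [tnum, scalar_zero]
  have h2 : screening (mon ⟨0, -Finsupp.single (l + 2) 1⟩) = -(mon (YMon.Y l) • S l) := by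
    rw [mon, screening_single, one_smul, ← Finsupp.single_neg, Finsupp.sum_single_index,
      tnum_neg_one, scalar_neg, scalar_T, show l + 2 = l + 1 + 1 by ring, S_add_one, ← mul_smul,
      neg_mul, neg_mul, mon_mul, mon_mul, neg_smul, add_sub_cancel_right]
    -- The powers of `t` cancel: `-2` from `tnum (-1)`, `1` from the relation, and `1` from moving
    -- `Ỹ_{l+2}⁻¹` past `Ã_{l+1}`.
    · congr 3
      rw [mul_assoc, YMon.t_mul 1, YMon.t_mul]
      refine YMon.ext ?_ ?_
      · simp only [YMon.mul_a, YMon.A, YMon.Y, bichar_alpha_right, Finsupp.single_apply]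
        simp only [show ¬ l + 1 + 1 = l + 1 - 1 by omega, if_true, if_false]
        norm_num
      · simp only [YMon.mul_u, YMon.A, YMon.Y, YMon.alpha, add_sub_cancel_right, Finsupp.single_neg]
        abel
    · simp [tnum, scalar_zero]
  rw [InKt, fund, screening_add, h1, h2, add_neg_cancel]

/-- All exponents of `x` are smaller than `v`. -/
def Below (v : ℤ →₀ ℤ) (x : Yt) : Prop := ∀ k ∈ x.coeff.support, v - k.u ∈ posCone

/-- All exponents of `x` are at most `v`. -/
def WeakBelow (v : ℤ →₀ ℤ) (x : Yt) : Prop :=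
  ∀ k ∈ x.coeff.support, k.u = v ∨ v - k.u ∈ posCone

theorem Below.weakBelow {v : ℤ →₀ ℤ} {x : Yt} (h : Below v x) : WeakBelow v x :=
  fun k hk => Or.inr (h k hk)

theorem mem_support_of_mem_add {x y : Yt} {k : YMon} (h : k ∈ (x + y).coeff.support) :
    k ∈ x.coeff.support ∨ k ∈ y.coeff.support := by
  classical
  rw [MonoidAlgebra.coeff_add] at h
  exact Finset.mem_union.1 (Finsupp.support_add h)

theorem exists_of_mem_support_mul {x y : Yt} {k : YMon} (h : k ∈ (x * y).coeff.support) :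
    ∃ i ∈ x.coeff.support, ∃ j ∈ y.coeff.support, i * j = k := by
  classical
  exact Finset.mem_mul.1 (MonoidAlgebra.support_coeff_mul_subset x y h)

theorem Below.add {v : ℤ →₀ ℤ} {x y : Yt} (hx : Below v x) (hy : Below v y) : Below v (x + y) :=
  fun k hk => (mem_support_of_mem_add hk).elim (hx k) (hy k)

theorem WeakBelow.add {v : ℤ →₀ ℤ} {x y : Yt} (hx : WeakBelow v x) (hy : WeakBelow v y) :
    WeakBelow v (x + y) :=
  fun k hk => (mem_support_of_mem_add hk).elim (hx k) (hy k)

theorem Below.mul_weakBelow {v w : ℤ →₀ ℤ} {x y : Yt} (hx : Below v x) (hy : WeakBelow w y) :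
    Below (v + w) (x * y) := by
  intro k hk
  obtain ⟨i, hi, j, hj, rfl⟩ := exists_of_mem_support_mul hk
  rw [YMon.mul_u, add_sub_add_comm]
  rcases hy j hj with h | h
  · rw [h, sub_self, add_zero]
    exact hx i hi
  · exact add_mem (hx i hi) h

theorem WeakBelow.mul_below {v w : ℤ →₀ ℤ} {x y : Yt} (hx : WeakBelow v x) (hy : Below w y) :
    Below (v + w) (x * y) := by
  intro k hk
  obtain ⟨i, hi, j, hj, rfl⟩ := exists_of_mem_support_mul hk
  rw [YMon.mul_u, add_sub_add_comm]
  rcases hx i hi with h | h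
  · rw [h, sub_self, zero_add]
    exact hy j hj
  · exact add_mem h (hy j hj)

theorem eq_of_mem_support_mon {g k : YMon} (h : k ∈ (mon g).coeff.support) : k = g := by
  classical
  rw [Finsupp.mem_support_iff, mon_coeff] at h
  by_contra h0
  exact h (if_neg (Ne.symm h0))

theorem weakBelow_mon (g : YMon) : WeakBelow g.u (mon g) :=
  fun _ hk => Or.inl (by rw [eq_of_mem_support_mon hk])

/-- `g` is the leading monomial of `x`, with coefficient `1`. -/
def IsLead (g : YMon) (x : Yt) : Prop := Below g.u (x - mon g)

theorem IsLead.weakBelow {g : YMon} {x : Yt} (h : IsLead g x) : WeakBelow g.u x := by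
  have := (weakBelow_mon g).add (Below.weakBelow h)
  rwa [add_sub_cancel] at this

theorem isLead_mon (g : YMon) : IsLead g (mon g) := by
  intro k hk
  simp at hk

theorem IsLead.mul {g h : YMon} {x y : Yt} (hx : IsLead g x) (hy : IsLead h y) :
    IsLead (g * h) (x * y) := by
  have h1 : x * y - mon (g * h) = (x - mon g) * y + mon g * (y - mon h) := by
    rw [sub_mul, mul_sub, mon_mul]
    abel
  rw [IsLead, h1, YMon.mul_u]
  exact (hx.mul_weakBelow hy.weakBelow).add ((weakBelow_mon g).mul_below hy)

theorem IsLead.pow {g : YMon} {x : Yt} (hx : IsLead g x) (n : ℕ) : IsLead (g ^ n) (x ^ n) := by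
  induction n with
  | zero => rw [pow_zero, pow_zero]; exact isLead_mon 1
  | succ n ih => rw [pow_succ, pow_succ]; exact ih.mul hx

theorem IsLead.orderedProd {s : Finset ℤ} {f : ℤ → YMon} {h : ℤ → Yt}
    (hf : ∀ l, IsLead (f l) (h l)) : IsLead (orderedProd s f) (orderedProd s h) := by
  unfold QTsl2.orderedProd
  induction s.sort (· ≤ ·) with
  | nil => exact isLead_mon 1
  | cons l ls ih =>
    rw [List.map_cons, List.map_cons, List.prod_cons, List.prod_cons]
    exact (hf l).mul ih

theorem InKt.orderedProd {s : Finset ℤ} {h : ℤ → Yt} (hh : ∀ l, InKt (h l)) :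
    InKt (orderedProd s h) := by
  unfold QTsl2.orderedProd
  induction s.sort (· ≤ ·) with
  | nil => exact InKt.one
  | cons l ls ih =>
    rw [List.map_cons, List.prod_cons]
    exact (hh l).mul ih

theorem orderedProd_congr {G : Type*} [Monoid G] {s : Finset ℤ} {f h : ℤ → G}
    (hfh : ∀ l ∈ s, f l = h l) : orderedProd s f = orderedProd s h := by
  unfold orderedProd
  congr 1
  exact List.map_congr_left fun l hl => hfh l ((Finset.mem_sort _).1 hl)

/-- The exponent vector, as a homomorphism. -/
def uHom : YMon →* Multiplicative (ℤ →₀ ℤ) where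
  toFun g := Multiplicative.ofAdd g.u
  map_one' := rfl
  map_mul' _ _ := rfl

theorem orderedProd_u (s : Finset ℤ) (f : ℤ → YMon) :
    (orderedProd s f).u = ∑ l ∈ s, (f l).u := by
  have h1 : uHom (orderedProd s f) = ∏ l ∈ s, uHom (f l) := by
    rw [orderedProd, map_list_prod, List.map_map]
    conv_rhs => rw [← Finset.sort_toFinset s (· ≤ ·)]
    rw [List.prod_toFinset _ (Finset.sort_nodup s _)]
    rfl
  have h2 := congrArg Multiplicative.toAdd h1
  rw [toAdd_prod] at h2
  exact h2

theorem Y_pow_u (l : ℤ) (n : ℕ) : (YMon.Y l ^ n).u = Finsupp.single l (n : ℤ) := by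
  induction n with
  | zero => simp [YMon.one_u]
  | succ n ih =>
    rw [pow_succ, YMon.mul_u, ih, YMon.Y, ← Finsupp.single_add]
    rfl

theorem orderedProd_Y_u (m : DomMon) :
    (orderedProd m.1.u.support fun l => YMon.Y l ^ (m.1.u l).toNat).u = m.1.u := by
  rw [orderedProd_u]
  conv_rhs => rw [← Finsupp.sum_single m.1.u, Finsupp.sum]
  refine Finset.sum_congr rfl fun l _ => ?_
  rw [Y_pow_u, Int.toNat_of_nonneg (m.2 l)]

theorem orderedProd_Y_zpow (m : DomMon) :
    (orderedProd m.1.u.support fun l => YMon.Y l ^ m.1.u l) =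
      orderedProd m.1.u.support fun l => YMon.Y l ^ (m.1.u l).toNat :=
  orderedProd_congr fun l _ => by
    rw [← zpow_natCast, Int.toNat_of_nonneg (m.2 l)]

/-- `x` lies in `𝔎_t`, has coefficient `1` at `m`, and its other dominant monomials are lower. -/
structure IsUni (m : DomMon) (x : Yt) : Prop where
  inKt : InKt x
  coeff_self : x.coeff m.1 = 1
  sub_mem (g : YMon) : g.Dominant → g ≠ m.1 → x.coeff g ≠ 0 → m.1.u - g.u ∈ posCone

theorem IsFt.isUni {m : DomMon} {x : Yt} (h : IsFt m x) : IsUni m x :=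
  ⟨h.1, h.2.1, fun g hg hne h0 => (h0 (h.2.2 g hg hne)).elim⟩

theorem IsLead.isUni {m : DomMon} {x : Yt} (h : IsLead m.1 x) (hK : InKt x) : IsUni m x := by
  classical
  have key : ∀ g, x.coeff g = (mon m.1).coeff g ∨ m.1.u - g.u ∈ posCone := by
    intro g
    by_cases hg : g ∈ (x - mon m.1).coeff.support
    · exact Or.inr (h g hg)
    · rw [Finsupp.notMem_support_iff, MonoidAlgebra.coeff_sub, Finsupp.sub_apply, sub_eq_zero] at hg
      exact Or.inl hg
  refine ⟨hK, ?_, fun g _ hne h0 => ?_⟩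
  · rcases key m.1 with h1 | h1
    · rw [h1, mon_coeff, if_pos rfl]
    · rw [sub_self] at h1
      exact (ne_zero_of_mem_posCone h1 rfl).elim
  · rcases key g with h1 | h1
    · rw [h1, mon_coeff, if_neg (Ne.symm hne)] at h0
      exact (h0 rfl).elim
    · exact h1

theorem isLead_fund (l : ℤ) : IsLead (YMon.Y l) (fund l) := by
  intro k hk
  rw [fund, add_sub_cancel_left] at hk
  rw [eq_of_mem_support_mon hk]
  have h := alpha_mem_posCone (l + 1)
  rw [YMon.alpha, add_sub_cancel_right, add_assoc] at h
  change Finsupp.single l 1 - -Finsupp.single (l + 2) 1 ∈ posCone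
  rw [sub_neg_eq_add]
  exact h

theorem ft_Y0 : Ft Y0 = fund 0 := by
  have h : IsUni Y0 (fund 0) := IsLead.isUni (m := Y0) (isLead_fund 0) (inKt_fund 0)
  refine ft_eq ⟨h.inKt, h.coeff_self, fun g hg hne => ?_⟩
  classical
  rw [fund, MonoidAlgebra.coeff_add, Finsupp.add_apply, mon_coeff, mon_coeff,
    if_neg (show ¬ YMon.Y 0 = g from fun h => hne h.symm), zero_add, if_neg]
  rintro rfl
  have := hg 2
  simp at this

theorem shift_fund (l : ℤ) : shift l (fund 0) = fund l := by
  unfold shift fund mon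
  rw [MonoidAlgebra.mapDomain_add, MonoidAlgebra.mapDomain_single, MonoidAlgebra.mapDomain_single]
  congr 2
  · simp [YMon.shift, YMon.Y, Finsupp.mapDomain_single]
  · refine YMon.ext rfl ?_
    simp only [YMon.shift, ← Finsupp.single_neg, Finsupp.mapDomain_single, zero_add, add_comm]

theorem et_eq (m : DomMon) : Et m =
    mon (m.1 * (orderedProd m.1.u.support fun l => YMon.Y l ^ (m.1.u l).toNat)⁻¹) *
      orderedProd m.1.u.support fun l => fund l ^ (m.1.u l).toNat := by
  simp only [Et, orderedProd_Y_zpow, ft_Y0, shift_fund]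

/-- Leading monomials multiply, and the prefactor in `E_t(m)` is a power of `t` that turns the
ordered product of the `Ỹ_l` into exactly `m`. -/
theorem isUni_et (m : DomMon) : IsUni m (Et m) := by
  rw [et_eq]
  refine IsLead.isUni ?_ ?_
  · have h : IsLead _ _ := (isLead_mon (m.1 * (orderedProd m.1.u.support
      fun l => YMon.Y l ^ (m.1.u l).toNat)⁻¹)).mul
      (IsLead.orderedProd (s := m.1.u.support) fun l => (isLead_fund l).pow (m.1.u l).toNat)
    rwa [inv_mul_cancel_right] at h
  · refine InKt.mul (inKt_single ?_ 1) (InKt.orderedProd fun l => (inKt_fund l).pow _)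
    rw [YMon.mul_u, YMon.inv_u, orderedProd_Y_u, add_neg_cancel]

/-! ### Existence and bar invariance of `F_t(m)`. -/

theorem coeff_single_t_mul (n c : ℤ) (x : Yt) (g : YMon) :
    (MonoidAlgebra.single (YMon.t n) c * x).coeff g = c * x.coeff (YMon.t (-n) * g) := by
  have h : MonoidAlgebra.single (YMon.t n) c = c • mon (YMon.t n) := by simp [mon]
  rw [h, smul_mul_assoc, MonoidAlgebra.coeff_smul_apply, coeff_mon_t_mul, smul_eq_mul]

theorem exists_of_coeff_scalar_mul_ne_zero {p : ℤ[T;T⁻¹]} {x : Yt} {g : YMon}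
    (h : (scalar p * x).coeff g ≠ 0) : ∃ n, p.coeff n ≠ 0 ∧ x.coeff (YMon.t (-n) * g) ≠ 0 := by
  rw [scalar, Finsupp.sum, Finset.sum_mul, MonoidAlgebra.coeff_sum, Finsupp.finsetSum_apply] at h
  obtain ⟨n, hn, h⟩ := Finset.exists_ne_zero_of_sum_ne_zero h
  rw [coeff_single_t_mul] at h
  exact ⟨n, left_ne_zero_of_mul h, right_ne_zero_of_mul h⟩

theorem IsFt.coeff_eq {m : DomMon} {x : Yt} (h : IsFt m x) {g : YMon} (hg : g.Dominant)
    [Decidable (g = m.1)] : x.coeff g = if g = m.1 then 1 else 0 := by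
  split_ifs with h0
  · rw [h0, h.2.1]
  · exact h.2.2 g hg h0

theorem IsFt.coeff_scalar_mul {m : DomMon} {x : Yt} (h : IsFt m x) (p : ℤ[T;T⁻¹]) {g : YMon}
    (hg : g.Dominant) :
    (scalar p * x).coeff g = if g.u = m.1.u then p.coeff (g.a - m.1.a) else 0 := by
  classical
  induction p using AddMonoidAlgebra.induction_linear with
  | zero => simp [scalar_zero]
  | add p q hp hq =>
    rw [scalar_add, add_mul, MonoidAlgebra.coeff_add, Finsupp.add_apply, hp, hq,
      AddMonoidAlgebra.coeff_add, Finsupp.add_apply]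
    split_ifs <;> simp
  | single n c =>
    have hd : (YMon.t (-n) * g).Dominant := by rw [YMon.t_mul]; exact hg
    rw [scalar_single, coeff_single_t_mul, h.coeff_eq hd, AddMonoidAlgebra.coeff_single,
      Finsupp.single_apply, YMon.t_mul, YMon.ext_iff]
    by_cases hu : g.u = m.1.u
    · simp only [hu, and_true, if_true, mul_ite, mul_one, mul_zero]
      exact if_congr (by omega) rfl rfl
    · simp [hu]

/-- The coefficient of `x` along `t^ℤ m`. -/
noncomputable def coefPoly (x : Yt) (m : DomMon) : ℤ[T;T⁻¹] :=
  AddMonoidAlgebra.ofCoeff (x.coeff.comapDomain (fun n : ℤ => (⟨n + m.1.a, m.1.u⟩ : YMon))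
    (fun a _ b _ h => by simpa using congrArg YMon.a h))

theorem coefPoly_coeff (x : Yt) (m : DomMon) (n : ℤ) :
    (coefPoly x m).coeff n = x.coeff ⟨n + m.1.a, m.1.u⟩ := rfl

theorem exists_mem_lower {m : DomMon} {g : YMon} (hg : g.Dominant)
    (h : m.1.u - g.u ∈ posCone) : ∃ m' ∈ lower m, m'.1.u = g.u :=
  ⟨⟨⟨m.1.a, g.u⟩, hg⟩, (mem_lower_iff _ _).2 ⟨rfl, h⟩, rfl⟩

theorem eq_of_mem_lower {m m₁ m₂ : DomMon} (h₁ : m₁ ∈ lower m) (h₂ : m₂ ∈ lower m)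
    (h : m₁.1.u = m₂.1.u) : m₁ = m₂ := by
  rw [mem_lower_iff] at h₁ h₂
  exact Subtype.ext (YMon.ext (h₁.1.trans h₂.1.symm) h)

/-- A dominant `g` in the cone below `m` has the exponent vector of exactly one `m' ∈ lower m`, so
only that summand contributes at `g`, and `coefPoly` is built to contribute the coefficient of `x`.
-/
theorem coeff_sum_coefPoly_mul {m : DomMon} {f : DomMon → Yt}
    (hf : ∀ m' ∈ lower m, IsFt m' (f m')) (x : Yt) {g : YMon} (hg : g.Dominant)
    [Decidable (m.1.u - g.u ∈ posCone)] :
    (∑ m' ∈ (lower_finite m).toFinset, scalar (coefPoly x m') * f m').coeff g =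
      if m.1.u - g.u ∈ posCone then x.coeff g else 0 := by
  rw [MonoidAlgebra.coeff_sum, Finsupp.finsetSum_apply]
  have key : ∀ m' ∈ (lower_finite m).toFinset, (scalar (coefPoly x m') * f m').coeff g =
      if g.u = m'.1.u then x.coeff g else 0 := by
    intro m' hm'
    rw [(hf m' ((Set.Finite.mem_toFinset _).1 hm')).coeff_scalar_mul _ hg]
    refine if_ctx_congr Iff.rfl (fun h => ?_) fun _ => rfl
    rw [coefPoly_coeff, sub_add_cancel, ← h]
  rw [Finset.sum_congr rfl key]
  split_ifs with h
  · obtain ⟨m₀, hm₀, hu⟩ := exists_mem_lower hg h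
    rw [Finset.sum_eq_single_of_mem m₀ ((Set.Finite.mem_toFinset _).2 hm₀), if_pos hu.symm]
    intro m' hm' hne
    refine if_neg fun h' => hne (eq_of_mem_lower ((Set.Finite.mem_toFinset _).1 hm') hm₀ ?_)
    rw [hu, h']
  · refine Finset.sum_eq_zero fun m' hm' => if_neg fun h' => h ?_
    rw [h']
    exact ((mem_lower_iff m m').1 ((Set.Finite.mem_toFinset _).1 hm')).2

theorem InKt.sum_scalar_mul {s : Finset DomMon} {f : DomMon → Yt} (r : DomMon → ℤ[T;T⁻¹])
    (hf : ∀ m ∈ s, InKt (f m)) : InKt (∑ m ∈ s, QTsl2.scalar (r m) * f m) :=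
  InKt.sum s fun m hm => (InKt.scalar (r m)).mul (hf m hm)

theorem exists_isFt (m : DomMon) : ∃ x, IsFt m x := by
  classical
  induction hd : domDeg m using Nat.strong_induction_on generalizing m with
  | _ d ih =>
    subst hd
    have hF : ∀ m' ∈ lower m, IsFt m' (Ft m') := fun m' hm' =>
      Classical.epsilon_spec (ih _ (domDeg_lt hm') m' rfl)
    have hE := isUni_et m
    refine ⟨Et m - ∑ m' ∈ (lower_finite m).toFinset, scalar (coefPoly (Et m) m') * Ft m', ?_, ?_, ?_⟩
    · exact hE.inKt.sub (InKt.sum_scalar_mul _ fun m' hm' =>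
        (hF m' ((Set.Finite.mem_toFinset _).1 hm')).1)
    · rw [MonoidAlgebra.coeff_sub, Finsupp.sub_apply, coeff_sum_coefPoly_mul hF _ m.2, if_neg,
        sub_zero, hE.coeff_self]
      rw [sub_self]
      exact fun h => ne_zero_of_mem_posCone h rfl
    · intro g hg hne
      rw [MonoidAlgebra.coeff_sub, Finsupp.sub_apply, coeff_sum_coefPoly_mul hF _ hg]
      split_ifs with h
      · rw [sub_self]
      · rw [sub_zero]
        by_contra h0
        exact h (hE.sub_mem g hg hne h0)

theorem isFt_ft (m : DomMon) : IsFt m (Ft m) := Classical.epsilon_spec (exists_isFt m)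

/-- `bar x = (bar m) m⁻¹ x`. -/
def IsBarInv (m : DomMon) (x : Yt) : Prop := bar x = mon (m.1.bar * m.1⁻¹) * x

/-- Both sides lie in `𝔎_t`, so it suffices that their single dominant monomials agree. -/
theorem isBarInv_ft (m : DomMon) : IsBarInv m (Ft m) := by
  classical
  have h := isFt_ft m
  rw [IsBarInv, YMon.bar_mul_inv]
  refine h.1.bar.ext ?_ fun g hg => ?_
  · rw [← scalar_T]
    exact (InKt.scalar _).mul h.1
  · rw [coeff_bar, coeff_mon_t_mul, h.coeff_eq (g := g.bar) hg,
      h.coeff_eq (g := YMon.t _ * g) (by rw [YMon.t_mul]; exact hg)]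
    refine if_congr ?_ rfl rfl
    rw [YMon.t_mul, YMon.ext_iff, YMon.ext_iff]
    simp only [YMon.bar]
    constructor
    · rintro ⟨h1, h2⟩
      rw [h2] at h1
      exact ⟨by omega, h2⟩
    · rintro ⟨h1, h2⟩
      exact ⟨by rw [h2]; omega, h2⟩

/-- One and the same power of `t` serves for all of `lower m`; this is why the expansions run over
`B^inv_m`, where the bar symmetry acts on coefficients simply by `t ↦ t⁻¹`. -/
theorem bar_mul_inv_eq_of_mem_lower {m m' : DomMon} (h : m' ∈ lower m) :
    m'.1.bar * m'.1⁻¹ = m.1.bar * m.1⁻¹ := by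
  rw [mem_lower_iff] at h
  rw [YMon.bar_mul_inv, YMon.bar_mul_inv, h.1, bichar_self_eq_of_sub_mem h.2]

theorem bar_sum_scalar_mul {m : DomMon} {f : DomMon → Yt} (hf : ∀ m' ∈ lower m, IsBarInv m' (f m'))
    (r : DomMon → ℤ[T;T⁻¹]) :
    bar (∑ m' ∈ (lower_finite m).toFinset, scalar (r m') * f m') =
      mon (m.1.bar * m.1⁻¹) * ∑ m' ∈ (lower_finite m).toFinset,
        scalar (LaurentPolynomial.invert (r m')) * f m' := by
  rw [bar_sum, Finset.mul_sum]
  refine Finset.sum_congr rfl fun m' hm' => ?_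
  have hm' := (Set.Finite.mem_toFinset _).1 hm'
  rw [bar_mul, hf m' hm', bar_mul_inv_eq_of_mem_lower hm', bar_scalar, mul_assoc, scalar_commute]

/-! ### Unitriangular families and bar-invariant splittings. -/

/-- `x` is a `ℤ[t^±]`-linear combination of the `f m`, `m ∈ s`. -/
def InSpan (f : DomMon → Yt) (s : Finset DomMon) (x : Yt) : Prop :=
  ∃ r : DomMon → ℤ[T;T⁻¹], x = ∑ m ∈ s, scalar (r m) * f m

section InSpan

variable {f : DomMon → Yt} {s : Finset DomMon}

theorem InSpan.zero : InSpan f s 0 := ⟨0, by simp [scalar_zero]⟩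

theorem InSpan.add {x y : Yt} (hx : InSpan f s x) (hy : InSpan f s y) : InSpan f s (x + y) := by
  obtain ⟨r, rfl⟩ := hx
  obtain ⟨q, rfl⟩ := hy
  refine ⟨r + q, ?_⟩
  rw [← Finset.sum_add_distrib]
  refine Finset.sum_congr rfl fun m _ => ?_
  rw [Pi.add_apply, scalar_add, add_mul]

theorem InSpan.scalar_mul {x : Yt} (hx : InSpan f s x) (p : ℤ[T;T⁻¹]) :
    InSpan f s (scalar p * x) := by
  obtain ⟨r, rfl⟩ := hx
  refine ⟨fun m => p * r m, ?_⟩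
  rw [Finset.mul_sum]
  refine Finset.sum_congr rfl fun m _ => ?_
  rw [QTsl2.scalar_mul, mul_assoc]

theorem InSpan.sum {ι : Type*} (u : Finset ι) {g : ι → Yt} (h : ∀ i ∈ u, InSpan f s (g i)) :
    InSpan f s (∑ i ∈ u, g i) :=
  Finset.sum_induction g (InSpan f s) (fun _ _ => InSpan.add) InSpan.zero h

theorem InSpan.of_mem {m : DomMon} (hm : m ∈ s) : InSpan f s (f m) := by
  classical
  refine ⟨fun m' => if m' = m then 1 else 0, ?_⟩
  rw [Finset.sum_eq_single_of_mem m hm]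
  · simp only [if_true, scalar_one, one_mul]
  · intro m' _ hne
    simp only [hne, if_false, scalar_zero, zero_mul]

theorem InSpan.mono {s' : Finset DomMon} (hs : s ⊆ s') {x : Yt} (hx : InSpan f s x) :
    InSpan f s' x := by
  obtain ⟨r, rfl⟩ := hx
  exact InSpan.sum _ fun m hm => (InSpan.of_mem (hs hm)).scalar_mul _

end InSpan

theorem eq_sum_coefPoly_mul_ft {m : DomMon} {x : Yt} (hx : InKt x)
    (h : ∀ g : YMon, g.Dominant → x.coeff g ≠ 0 → m.1.u - g.u ∈ posCone) :
    x = ∑ m' ∈ (lower_finite m).toFinset, scalar (coefPoly x m') * Ft m' := by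
  classical
  refine hx.ext (InKt.sum_scalar_mul _ fun m' _ => (isFt_ft m').1) fun g hg => ?_
  rw [coeff_sum_coefPoly_mul (fun m' _ => isFt_ft m') x hg]
  split_ifs with h1
  · rfl
  · by_contra h0
    exact h1 (h g hg h0)

/-- The `F_t(m')` span by rigidity. Each one differs from `f m'` by something supported, on dominant
monomials, strictly below `m'`, so induction on the degree changes basis. -/
theorem inSpan_lower {m : DomMon} {f : DomMon → Yt} (hf : ∀ m' ∈ lower m, IsUni m' (f m'))
    {x : Yt} (hx : InKt x)
    (h : ∀ g : YMon, g.Dominant → x.coeff g ≠ 0 → m.1.u - g.u ∈ posCone) :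
    InSpan f (lower_finite m).toFinset x := by
  induction hd : domDeg m using Nat.strong_induction_on generalizing m x with
  | _ d ih =>
    subst hd
    rw [eq_sum_coefPoly_mul_ft hx h]
    refine InSpan.sum _ fun m' hm' => InSpan.scalar_mul ?_ _
    have hm := (Set.Finite.mem_toFinset _).1 hm'
    have hU := hf m' hm
    have hF := isFt_ft m'
    have h1 : InSpan f (lower_finite m').toFinset (Ft m' - f m') := by
      refine ih _ (domDeg_lt hm) (fun m'' hm'' => hf m'' (mem_lower_trans hm hm''))
        (hF.1.sub hU.inKt) (fun g hg hne => ?_) rfl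
      rw [MonoidAlgebra.coeff_sub, Finsupp.sub_apply] at hne
      by_cases hgm : g = m'.1
      · rw [hgm, hF.2.1, hU.coeff_self, sub_self] at hne
        exact (hne rfl).elim
      · rw [hF.2.2 g hg hgm, zero_sub, neg_ne_zero] at hne
        exact hU.sub_mem g hg hgm hne
    have h2 : InSpan f (lower_finite m).toFinset (Ft m' - f m') := h1.mono fun m'' hm'' =>
      (Set.Finite.mem_toFinset _).2 (mem_lower_trans hm ((Set.Finite.mem_toFinset _).1 hm''))
    have h3 := h2.add (InSpan.of_mem (f := f) hm')
    rwa [sub_add_cancel] at h3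

theorem IsUni.coeff_scalar_mul_self {m : DomMon} {x : Yt} (h : IsUni m x) (p : ℤ[T;T⁻¹]) (n : ℤ) :
    (scalar p * x).coeff ⟨n + m.1.a, m.1.u⟩ = p.coeff n := by
  classical
  induction p using AddMonoidAlgebra.induction_linear with
  | zero => simp [scalar_zero]
  | add p q hp hq =>
    rw [scalar_add, add_mul, MonoidAlgebra.coeff_add, Finsupp.add_apply, hp, hq,
      AddMonoidAlgebra.coeff_add, Finsupp.add_apply]
  | single k c =>
    rw [scalar_single, coeff_single_t_mul, AddMonoidAlgebra.coeff_single, Finsupp.single_apply,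
      YMon.t_mul]
    split_ifs with hk
    · subst hk
      rw [neg_add_cancel_left]
      change c * x.coeff m.1 = c
      rw [h.coeff_self, mul_one]
    · by_contra h0
      have h1 := h.sub_mem ⟨-k + (n + m.1.a), m.1.u⟩ m.2
        (fun h2 => hk (by have := congrArg YMon.a h2; simp only at this; omega))
        (right_ne_zero_of_mul h0)
      rw [sub_self] at h1
      exact ne_zero_of_mem_posCone h1 rfl

theorem IsUni.of_coeff_scalar_mul_ne_zero {m : DomMon} {x : Yt} (h : IsUni m x) {p : ℤ[T;T⁻¹]}
    {g : YMon} (hg : g.Dominant) (h0 : (scalar p * x).coeff g ≠ 0) :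
    m.1.u = g.u ∨ m.1.u - g.u ∈ posCone := by
  obtain ⟨n, -, hn⟩ := exists_of_coeff_scalar_mul_ne_zero h0
  rw [YMon.t_mul] at hn
  by_cases h1 : (⟨-n + g.a, g.u⟩ : YMon) = m.1
  · exact Or.inl (by rw [← h1])
  · exact Or.inr (h.sub_mem ⟨-n + g.a, g.u⟩ hg h1 hn)

/-- Take `m₀` of maximal degree with nonzero coefficient; no other summand reaches `t^ℤ m₀`. -/
theorem eq_zero_of_sum_scalar_mul_eq_zero {m : DomMon} {f : DomMon → Yt}
    (hf : ∀ m' ∈ lower m, IsUni m' (f m')) {r : DomMon → ℤ[T;T⁻¹]}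
    (h : ∑ m' ∈ (lower_finite m).toFinset, scalar (r m') * f m' = 0) :
    ∀ m' ∈ lower m, r m' = 0 := by
  classical
  by_contra! hne
  obtain ⟨m₁, hm₁, hr₁⟩ := hne
  obtain ⟨m₀, hm₀, hmax⟩ := Finset.exists_max_image
    ((lower_finite m).toFinset.filter fun m' => r m' ≠ 0) domDeg
    ⟨m₁, Finset.mem_filter.2 ⟨(Set.Finite.mem_toFinset _).2 hm₁, hr₁⟩⟩
  rw [Finset.mem_filter] at hm₀
  obtain ⟨hm₀, hr₀⟩ := hm₀
  have hm₀' := (Set.Finite.mem_toFinset _).1 hm₀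
  refine hr₀ (LaurentPolynomial.ext fun n => ?_)
  have h1 := congrArg (fun x : Yt => x.coeff ⟨n + m₀.1.a, m₀.1.u⟩) h
  simp only [MonoidAlgebra.coeff_sum, Finsupp.finsetSum_apply] at h1
  rw [Finset.sum_eq_single_of_mem m₀ hm₀, (hf m₀ hm₀').coeff_scalar_mul_self] at h1
  · exact h1
  · intro m' hm' hne
    have hm'' := (Set.Finite.mem_toFinset _).1 hm'
    by_contra h0
    rcases (hf m' hm'').of_coeff_scalar_mul_ne_zero (g := ⟨n + m₀.1.a, m₀.1.u⟩) m₀.2 h0 with h2 | h2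
    · exact hne (eq_of_mem_lower hm'' hm₀' h2)
    · have hr : r m' ≠ 0 := by
        intro hr
        rw [hr, scalar_zero, zero_mul] at h0
        exact h0 rfl
      have h3 := hmax m' (Finset.mem_filter.2 ⟨hm', hr⟩)
      have h4 : domDeg m₀ < domDeg m' := domDeg_lt_of_sub_mem h2
      omega

theorem IsUni.add_sum_scalar_mul {m : DomMon} {x : Yt} (hx : IsUni m x) {f : DomMon → Yt}
    (hf : ∀ m' ∈ lower m, IsUni m' (f m')) (r : DomMon → ℤ[T;T⁻¹]) :
    IsUni m (x + ∑ m' ∈ (lower_finite m).toFinset, scalar (r m') * f m') := by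
  have key : ∀ g : YMon, g.Dominant →
      (∑ m' ∈ (lower_finite m).toFinset, scalar (r m') * f m').coeff g ≠ 0 →
      m.1.u - g.u ∈ posCone := by
    intro g hg h0
    rw [MonoidAlgebra.coeff_sum, Finsupp.finsetSum_apply] at h0
    obtain ⟨m', hm', h0⟩ := Finset.exists_ne_zero_of_sum_ne_zero h0
    have hm' := (Set.Finite.mem_toFinset _).1 hm'
    have h1 := ((mem_lower_iff m m').1 hm').2
    rcases (hf m' hm').of_coeff_scalar_mul_ne_zero hg h0 with h2 | h2
    · rwa [← h2]
    · have h3 := add_mem h1 h2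
      rwa [sub_add_sub_cancel] at h3
  refine ⟨hx.inKt.add (InKt.sum_scalar_mul _ fun m' hm' =>
    (hf m' ((Set.Finite.mem_toFinset _).1 hm')).inKt), ?_, fun g hg hne h0 => ?_⟩
  · rw [MonoidAlgebra.coeff_add, Finsupp.add_apply, hx.coeff_self, add_eq_left]
    by_contra h0
    have h1 := key m.1 m.2 h0
    rw [sub_self] at h1
    exact ne_zero_of_mem_posCone h1 rfl
  · rw [MonoidAlgebra.coeff_add, Finsupp.add_apply] at h0
    by_cases h1 : x.coeff g = 0
    · rw [h1, zero_add] at h0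
      exact key g hg h0
    · exact hx.sub_mem g hg hne h1

theorem mon_mul_left_cancel {g : YMon} {x y : Yt} (h : mon g * x = mon g * y) : x = y := by
  have h1 := congrArg (fun z => mon g⁻¹ * z) h
  simpa only [← mul_assoc, mon_mul, inv_mul_cancel, mon_one, one_mul] using h1

/-- A bar invariant plus a combination with coefficients in `t⁻¹ ℤ[t⁻¹]` of bar invariants
determines the summands. -/
theorem eq_and_eq_of_add_sum_eq {m : DomMon} {f : DomMon → Yt}
    (hf : ∀ m' ∈ lower m, IsUni m' (f m')) (hfb : ∀ m' ∈ lower m, IsBarInv m' (f m'))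
    {x y : Yt} (hx : IsBarInv m x) (hy : IsBarInv m y) {P Q : DomMon → ℤ[T;T⁻¹]}
    (hP : ∀ m' ∈ lower m, ∀ n : ℤ, 0 ≤ n → (P m').coeff n = 0)
    (hQ : ∀ m' ∈ lower m, ∀ n : ℤ, 0 ≤ n → (Q m').coeff n = 0)
    (h : x + ∑ m' ∈ (lower_finite m).toFinset, scalar (P m') * f m' =
      y + ∑ m' ∈ (lower_finite m).toFinset, scalar (Q m') * f m') :
    x = y ∧ ∀ m' ∈ lower m, P m' = Q m' := by
  have h1 : y - x = ∑ m' ∈ (lower_finite m).toFinset, scalar (P m' - Q m') * f m' := by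
    simp only [scalar_sub, sub_mul, Finset.sum_sub_distrib]
    rw [sub_eq_sub_iff_add_eq_add, ← h, add_comm]
  have h2 := congrArg bar h1
  rw [bar_sub, hx, hy, ← mul_sub, h1, bar_sum_scalar_mul hfb (fun m' => P m' - Q m')] at h2
  have h3 := sub_eq_zero.2 (mon_mul_left_cancel h2)
  simp only [← Finset.sum_sub_distrib, ← sub_mul, ← scalar_sub] at h3
  have h4 := eq_zero_of_sum_scalar_mul_eq_zero hf
    (r := fun m' => P m' - Q m' - LaurentPolynomial.invert (P m' - Q m')) h3
  -- The difference is invariant under `t ↦ t⁻¹` and has only negative exponents, so it vanishes.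
  have h5 : ∀ m' ∈ lower m, P m' = Q m' := by
    intro m' hm'
    have h6 := sub_eq_zero.1 (h4 m' hm')
    rw [← sub_eq_zero]
    have h7 : ∀ n : ℤ, 0 ≤ n → (P m' - Q m').coeff n = 0 := fun n hn => by
      rw [AddMonoidAlgebra.coeff_sub, Finsupp.sub_apply, hP m' hm' n hn, hQ m' hm' n hn, sub_zero]
    refine LaurentPolynomial.ext fun n => ?_
    rcases le_total 0 n with hn | hn
    · exact h7 n hn
    · rw [h6, LaurentPolynomial.invert_apply]
      exact h7 (-n) (by omega)
  refine ⟨?_, h5⟩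
  rw [Finset.sum_congr rfl fun m' hm' => by
    rw [h5 m' ((Set.Finite.mem_toFinset _).1 hm')]] at h
  exact add_right_cancel h

/-- On monomials: negative powers go to `p`, constants to `s`, and for `k > 0` one writes `t^k =
(t^k + t^{-k}) - t^{-k}`. -/
theorem exists_invert_eq_add (r : ℤ[T;T⁻¹]) : ∃ s p : ℤ[T;T⁻¹], r = s + p ∧
    LaurentPolynomial.invert s = s ∧ ∀ n : ℤ, 0 ≤ n → p.coeff n = 0 := by
  induction r using AddMonoidAlgebra.induction_linear with
  | zero => exact ⟨0, 0, by simp, by simp, by simp⟩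
  | add f g hf hg =>
    obtain ⟨s, p, h1, h2, h3⟩ := hf
    obtain ⟨s', p', h1', h2', h3'⟩ := hg
    refine ⟨s + s', p + p', by rw [h1, h1']; abel, by rw [map_add, h2, h2'], fun n hn => ?_⟩
    rw [AddMonoidAlgebra.coeff_add, Finsupp.add_apply, h3 n hn, h3' n hn, add_zero]
  | single k c =>
    have neg : ∀ (j d n : ℤ), j < 0 → 0 ≤ n →
        (AddMonoidAlgebra.single j d : ℤ[T;T⁻¹]).coeff n = 0 := by
      intro j d n hj hn
      rw [AddMonoidAlgebra.coeff_single, Finsupp.single_apply, if_neg (by omega)]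
    have inv : ∀ j : ℤ, LaurentPolynomial.invert (AddMonoidAlgebra.single j c : ℤ[T;T⁻¹]) =
        AddMonoidAlgebra.single (-j) c := by
      intro j
      rw [LaurentPolynomial.single_eq_C_mul_T, map_mul, LaurentPolynomial.invert_C,
        LaurentPolynomial.invert_T, ← LaurentPolynomial.single_eq_C_mul_T]
    rcases lt_trichotomy k 0 with hk | rfl | hk
    · exact ⟨0, _, (zero_add _).symm, map_zero _, fun n hn => neg k c n hk hn⟩
    · exact ⟨_, 0, (add_zero _).symm, by rw [inv, neg_zero], fun n _ => rfl⟩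
    · refine ⟨AddMonoidAlgebra.single k c + AddMonoidAlgebra.single (-k) c,
        AddMonoidAlgebra.single (-k) (-c), ?_, ?_, fun n hn => neg (-k) (-c) n (by omega) hn⟩
      · rw [add_assoc, ← AddMonoidAlgebra.single_add, add_neg_cancel,
          AddMonoidAlgebra.single_zero, add_zero]
      · rw [map_add, inv, inv, neg_neg, add_comm]

/-! ### Existence and uniqueness of the Kazhdan–Lusztig families. -/

/-- Recursion along `d` in which a next value is known to exist only if the earlier values are
already correct. Values are therefore chosen unconditionally and shown correct afterwards. -/
theorem exists_forall_of_wf {α β : Type*} [Nonempty β] (d : α → ℕ) (R : α → (α → β) → β → Prop)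
    (hcongr : ∀ a L L' b, (∀ a', d a' < d a → L a' = L' a') → R a L b → R a L' b)
    (hex : ∀ a L, (∀ a', d a' < d a → R a' L (L a')) → ∃ b, R a L b) :
    ∃ L : α → β, ∀ a, R a L (L a) := by
  classical
  let b₀ : β := Classical.arbitrary β
  let G : ∀ a, (∀ a', d a' < d a → β) → β := fun a ih =>
    -- The default `b₀` fills the arguments that are not smaller; `hcongr` makes it irrelevant.
    Classical.epsilon (R a fun a' => if h : d a' < d a then ih a' h else b₀)
  let L : α → β := (measure d).wf.fix G
  have hL : ∀ a, L a = Classical.epsilon (R a fun a' => if d a' < d a then L a' else b₀) := by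
    intro a
    rw [show L a = G a fun a' _ => L a' from (measure d).wf.fix_eq G a]
    simp only [G, dite_eq_ite]
  refine ⟨L, fun a => ?_⟩
  induction hd : d a using Nat.strong_induction_on generalizing a with
  | _ n ih =>
    subst hd
    have h1 : ∃ b, R a L b := hex a L fun a' ha' => ih _ ha' a' rfl
    obtain ⟨b, hb⟩ := h1
    have h2 : R a (fun a' => if d a' < d a then L a' else b₀) b :=
      hcongr a L _ b (fun a' ha' => (if_pos ha').symm) hb
    have h3 := Classical.epsilon_spec (p := R a fun a' => if d a' < d a then L a' else b₀) ⟨b, h2⟩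
    rw [← hL] at h3
    exact hcongr a _ L _ (fun a' ha' => if_pos ha') h3

/-- `x` is a possible value of `L_t(m)`, given the values `L` on `lower m`. -/
structure KLStep (m : DomMon) (L : DomMon → Yt) (x : Yt) : Prop where
  isUni : IsUni m x
  isBarInv : IsBarInv m x
  expand : ∃ P : DomMon → ℤ[T;T⁻¹], (∀ m' (n : ℤ), 0 ≤ n → (P m').coeff n = 0) ∧
    Et m = x + ∑ m' ∈ (lower_finite m).toFinset, scalar (P m') * L m'

/-- Expand `E_t(m) - F_t(m)` in the lower `L`'s and split each coefficient: the symmetric parts are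
added to `F_t(m)` to form `L_t(m)`, the negative parts are the `P`. -/
theorem exists_klStep {m : DomMon} {L : DomMon → Yt} (hU : ∀ m' ∈ lower m, IsUni m' (L m'))
    (hB : ∀ m' ∈ lower m, IsBarInv m' (L m')) : ∃ x, KLStep m L x := by
  have hE := isUni_et m
  have hF := isFt_ft m
  obtain ⟨r, hr⟩ : InSpan L (lower_finite m).toFinset (Et m - Ft m) := by
    refine inSpan_lower hU (hE.inKt.sub hF.1) fun g hg hne => ?_
    rw [MonoidAlgebra.coeff_sub, Finsupp.sub_apply] at hne
    by_cases hgm : g = m.1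
    · rw [hgm, hF.2.1, hE.coeff_self, sub_self] at hne
      exact (hne rfl).elim
    · rw [hF.2.2 g hg hgm, sub_zero] at hne
      exact hE.sub_mem g hg hgm hne
  choose s P h1 h2 h3 using fun m' => exists_invert_eq_add (r m')
  refine ⟨Ft m + ∑ m' ∈ (lower_finite m).toFinset, scalar (s m') * L m',
    hF.isUni.add_sum_scalar_mul hU s, ?_, P, h3, ?_⟩
  · rw [IsBarInv, bar_add, isBarInv_ft, bar_sum_scalar_mul hB, ← mul_add]
    simp only [h2]
  · rw [sub_eq_iff_eq_add'] at hr
    rw [hr, add_assoc, ← Finset.sum_add_distrib]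
    simp only [h1, scalar_add, add_mul]

theorem exists_isKL : ∃ q : (DomMon → Yt) × (DomMon → DomMon → ℤ[T;T⁻¹]), IsKL q.1 q.2 := by
  classical
  obtain ⟨L, hL⟩ := exists_forall_of_wf domDeg KLStep
    (by
      rintro m L L' x h ⟨hU, hB, P, hP, hE⟩
      refine ⟨hU, hB, P, hP, hE.trans ?_⟩
      congr 1
      refine Finset.sum_congr rfl fun m' hm' => ?_
      rw [h m' (domDeg_lt ((Set.Finite.mem_toFinset _).1 hm'))])
    (fun m L h => exists_klStep (fun m' hm' => (h m' (domDeg_lt hm')).isUni)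
      fun m' hm' => (h m' (domDeg_lt hm')).isBarInv)
  choose P hP hE using fun m => (hL m).expand
  refine ⟨(L, fun m' m => if m' ∈ lower m then P m m' else 0), fun m => (hL m).isUni.inKt,
    fun m => (hL m).isBarInv, fun m => (hE m).trans ?_, fun m m' n hn => ?_,
    fun m m' h => if_neg h⟩
  · congr 1
    refine Finset.sum_congr rfl fun m' hm' => ?_
    simp only [(Set.Finite.mem_toFinset _).1 hm', if_true]
  · change (if m' ∈ lower m then P m m' else 0).coeff n = 0
    split_ifs
    · exact hP m m' n hn
    · rfl

/-- Triangularity is not part of `IsKL`; it follows by solving the expansion of `E_t(m)` for `L m`.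
-/
theorem IsKL.isUni {L : DomMon → Yt} {P : DomMon → DomMon → ℤ[T;T⁻¹]} (h : IsKL L P)
    (m : DomMon) : IsUni m (L m) := by
  induction hd : domDeg m using Nat.strong_induction_on generalizing m with
  | _ d ih =>
    subst hd
    have h1 := (isUni_et m).add_sum_scalar_mul (f := L)
      (fun m' hm' => ih _ (domDeg_lt hm') m' rfl) fun m' => -P m' m
    simp only [scalar_neg, neg_mul, Finset.sum_neg_distrib] at h1
    rwa [h.expand m, add_neg_cancel_right] at h1

/-- Only a local expansion at `m` is asked of `L'`. This serves both for uniqueness of the families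
and for comparing `L_t` with `F_t`, which satisfies such an expansion only at multiplicity-free `m`.
-/
theorem IsKL.eq_of_eqOn_lower {L : DomMon → Yt} {P : DomMon → DomMon → ℤ[T;T⁻¹]} (h : IsKL L P)
    {m : DomMon} {L' : DomMon → Yt} (hL : ∀ m' ∈ lower m, L m' = L' m') (hB : IsBarInv m (L' m))
    {Q : DomMon → ℤ[T;T⁻¹]} (hQ : ∀ m' ∈ lower m, ∀ n : ℤ, 0 ≤ n → (Q m').coeff n = 0)
    (hE : Et m = L' m + ∑ m' ∈ (lower_finite m).toFinset, scalar (Q m') * L' m') :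
    L m = L' m ∧ ∀ m' ∈ lower m, P m' m = Q m' := by
  refine eq_and_eq_of_add_sum_eq (f := L) (P := fun m' => P m' m) (fun m' _ => h.isUni m')
    (fun m' _ => h.bar_eq m') (h.bar_eq m) hB (fun m' _ => h.neg m m') hQ ?_
  rw [← h.expand, hE]
  congr 1
  refine Finset.sum_congr rfl fun m' hm' => ?_
  rw [hL m' ((Set.Finite.mem_toFinset _).1 hm')]

theorem IsKL.unique {L L' : DomMon → Yt} {P P' : DomMon → DomMon → ℤ[T;T⁻¹]} (h : IsKL L P)
    (h' : IsKL L' P') : L = L' ∧ P = P' := by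
  have key : ∀ m, L m = L' m := by
    intro m
    induction hd : domDeg m using Nat.strong_induction_on generalizing m with
    | _ d ih =>
      subst hd
      exact (h.eq_of_eqOn_lower (fun m' hm' => ih _ (domDeg_lt hm') m' rfl) (h'.bar_eq m)
        (fun m' _ => h'.neg m m') (h'.expand m)).1
  refine ⟨funext key, funext fun m' => funext fun m => ?_⟩
  by_cases hm : m' ∈ lower m
  · exact (h.eq_of_eqOn_lower (fun m' _ => key m') (h'.bar_eq m)
      (fun m' _ => h'.neg m m') (h'.expand m)).2 m' hm
  · rw [h.zero m m' hm, h'.zero m m' hm]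

theorem isKL_klPair : IsKL klPair.1 klPair.2 :=
  Classical.epsilon_spec (p := fun q : (DomMon → Yt) × (DomMon → DomMon → ℤ[T;T⁻¹]) =>
    IsKL q.1 q.2) exists_isKL

/-! ### Expansion of `E_t(m)` for multiplicity-free `m`. -/

theorem orderedProd_empty {G : Type*} [Monoid G] (f : ℤ → G) : orderedProd ∅ f = 1 := by
  simp [orderedProd]

theorem orderedProd_insert {G : Type*} [Monoid G] {s : Finset ℤ} {a : ℤ} (h : ∀ x ∈ s, a < x)
    (f : ℤ → G) : orderedProd (insert a s) f = f a * orderedProd s f := by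
  unfold orderedProd
  rw [Finset.sort_insert (r := (· ≤ ·)) (fun b hb => (h b hb).le) fun ha => lt_irrefl _ (h a ha),
    List.map_cons, List.prod_cons]

/-- The exponent vector of `∏_{l ∈ J} A_{l+1}`. -/
noncomputable def alphaSum (J : Finset ℤ) : ℤ →₀ ℤ := ∑ l ∈ J, YMon.alpha (l + 1)

theorem alphaSum_apply (J : Finset ℤ) (k : ℤ) :
    alphaSum J k = (if k ∈ J then 1 else 0) + if k - 2 ∈ J then 1 else 0 := by
  rw [alphaSum, Finsupp.finsetSum_apply]
  simp only [alpha_apply, Finset.sum_add_distrib, add_sub_cancel_right,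
    show ∀ x : ℤ, x + 1 + 1 = k ↔ x = k - 2 by intro x; omega, Finset.sum_ite_eq']

theorem bichar_alphaSum_right (J : Finset ℤ) (v : ℤ →₀ ℤ) :
    bichar v (alphaSum J) = ∑ l ∈ J, (v l - v (l + 2)) := by
  classical
  induction J using Finset.induction_on with
  | empty => rw [alphaSum, Finset.sum_empty, bichar_zero_right, Finset.sum_empty]
  | insert a J ha ih =>
    rw [alphaSum] at ih ⊢
    rw [Finset.sum_insert ha, Finset.sum_insert ha, bichar_add_right, ih, bichar_alpha_right,
      add_sub_cancel_right, add_assoc]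
    rfl

/-- At the smallest `k` of the symmetric difference, `k - 2` lies in both sets or in neither, so the
exponents at `k` differ. -/
theorem alphaSum_injective {J K : Finset ℤ} (h : alphaSum J = alphaSum K) : J = K := by
  classical
  by_contra hne
  have hs : (symmDiff J K).Nonempty := by
    rwa [Finset.nonempty_iff_ne_empty, ← Finset.bot_eq_empty, Ne, symmDiff_eq_bot]
  obtain ⟨k, hk, hmin⟩ := Finset.exists_min_image _ id hs
  have h1 : k - 2 ∉ symmDiff J K := fun h2 => by
    have := hmin _ h2
    simp only [id] at this
    omega
  have h3 := DFunLike.congr_fun h k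
  rw [alphaSum_apply, alphaSum_apply] at h3
  rw [Finset.mem_symmDiff] at hk h1
  by_cases a : k ∈ J <;> by_cases b : k ∈ K <;> by_cases c : k - 2 ∈ J <;>
    by_cases d : k - 2 ∈ K <;> simp [a, b, c, d] at hk h1 h3

theorem isAProd_neg_alphaSum (J : Finset ℤ) : YMon.IsAProd J.card (-alphaSum J) := by
  refine ⟨fun j => (J.equivFin.symm j : ℤ) + 1, ?_⟩
  rw [Equiv.sum_comp J.equivFin.symm fun l : J => YMon.alpha ((l : ℤ) + 1),
    Finset.sum_coe_sort J fun l => YMon.alpha (l + 1), alphaSum]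

theorem orderedProd_Y_u_apply (s : Finset ℤ) (k : ℤ) :
    (orderedProd s YMon.Y).u k = if k ∈ s then 1 else 0 := by
  rw [orderedProd_u, Finsupp.finsetSum_apply]
  simp only [YMon.Y, Finsupp.single_apply, Finset.sum_ite_eq']

/-- Induction by adjoining a new smallest index `a`. Choosing `Ỹ_a` creates no new power of `t` from
the `A_{l+1}` with `l > a`. Choosing `Ỹ_{a+2}⁻¹`, whose exponent vector is that of `Y_a A_{a+1}⁻¹`,
creates `t⁻¹` exactly when `Y_{a+2}` is present and not already used, that is, when `a + 2 ∈ s \ J`.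
-/
theorem orderedProd_fund (s : Finset ℤ) : orderedProd s fund =
    ∑ J ∈ s.powerset, mon ⟨(orderedProd s YMon.Y).a - (J.filter fun l => l + 2 ∈ s \ J).card,
      (orderedProd s YMon.Y).u - alphaSum J⟩ := by
  induction s using Finset.induction_on_min with
  | empty =>
    rw [Finset.powerset_empty, Finset.sum_singleton, orderedProd_empty, orderedProd_empty, alphaSum,
      Finset.sum_empty, Finset.filter_empty, Finset.card_empty, sub_zero, Nat.cast_zero, sub_zero]
    rfl
  | insert a s ha ih =>
    have has : a ∉ s := fun h => lt_irrefl _ (ha a h)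
    have hE : (Finsupp.single a 1 : ℤ →₀ ℤ) - YMon.alpha (a + 1) = -Finsupp.single (a + 2) 1 := by
      rw [YMon.alpha, add_sub_cancel_right, add_assoc]
      abel
    rw [Finset.sum_powerset_insert has, orderedProd_insert ha, orderedProd_insert ha, ih, fund,
      add_mul, Finset.mul_sum, Finset.mul_sum]
    congr 1
    · refine Finset.sum_congr rfl fun J hJ => ?_
      rw [Finset.mem_powerset] at hJ
      have h1 : bichar (Finsupp.single a 1) (alphaSum J) = 0 := by
        rw [bichar_alphaSum_right]
        refine Finset.sum_eq_zero fun l hl => ?_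
        have := ha l (hJ hl)
        rw [Finsupp.single_eq_of_ne (by omega), Finsupp.single_eq_of_ne (by omega), sub_zero]
      have h2 : (J.filter fun l => l + 2 ∈ insert a s \ J) = J.filter fun l => l + 2 ∈ s \ J := by
        refine Finset.filter_congr fun l hl => ?_
        have := ha l (hJ hl)
        simp only [Finset.mem_sdiff, Finset.mem_insert, show ¬ l + 2 = a by omega, false_or]
      rw [mon_mul, h2]
      congr 1
      refine YMon.ext ?_ ?_
      · simp only [YMon.mul_a, YMon.Y, bichar_sub_right, h1]
        ring
      · simp only [YMon.mul_u]
        abel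
    · refine Finset.sum_congr rfl fun J hJ => ?_
      rw [Finset.mem_powerset] at hJ
      have haJ : a ∉ J := fun h => has (hJ h)
      have h1 : bichar (Finsupp.single a 1) (alphaSum J) = 0 := by
        rw [bichar_alphaSum_right]
        refine Finset.sum_eq_zero fun l hl => ?_
        have := ha l (hJ hl)
        rw [Finsupp.single_eq_of_ne (by omega), Finsupp.single_eq_of_ne (by omega), sub_zero]
      have h2 : (((insert a J).filter fun l => l + 2 ∈ insert a s \ insert a J).card : ℤ) =
          (J.filter fun l => l + 2 ∈ s \ J).card + if a + 2 ∈ s \ J then 1 else 0 := by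
        have h3 : ((insert a J).filter fun l => l + 2 ∈ insert a s \ insert a J) =
            (insert a J).filter fun l => l + 2 ∈ s \ J := by
          refine Finset.filter_congr fun l hl => ?_
          have : a ≤ l := by
            rcases Finset.mem_insert.1 hl with rfl | hl
            · exact le_rfl
            · exact (ha l (hJ hl)).le
          simp only [Finset.mem_sdiff, Finset.mem_insert, show ¬ l + 2 = a by omega, false_or]
        rw [h3, Finset.filter_insert]
        split_ifs with h4
        · rw [Finset.card_insert_of_notMem fun h => haJ (Finset.mem_filter.1 h).1]
          push_cast
          rfl
        · rw [add_zero]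
      have h5 : alphaSum (insert a J) = YMon.alpha (a + 1) + alphaSum J := by
        rw [alphaSum, Finset.sum_insert haJ, alphaSum]
      have h6 : a - 2 ∉ J := fun h => by
        have := ha _ (hJ h)
        omega
      have h7 : bichar (YMon.alpha (a + 1)) ((orderedProd s YMon.Y).u - alphaSum J) =
          if a + 2 ∈ s \ J then 1 else 0 := by
        rw [bichar_alpha_left, show a + 1 + 1 = a + 2 by ring, add_sub_cancel_right,
          Finsupp.sub_apply, Finsupp.sub_apply, orderedProd_Y_u_apply, orderedProd_Y_u_apply,
          alphaSum_apply, alphaSum_apply, if_neg has, if_neg haJ, if_neg h6,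
          add_sub_cancel_right, if_neg haJ]
        by_cases h8 : a + 2 ∈ J
        · simp [h8, hJ h8]
        · simp [h8]
      rw [mon_mul, h2, h5, ← hE]
      congr 1
      refine YMon.ext ?_ ?_
      · simp only [YMon.mul_a, YMon.Y]
        rw [bichar_sub_left, h7, bichar_sub_right, h1]
        ring
      · simp only [YMon.mul_u, YMon.Y]
        abel

/-- Here `c k` is the multiplicity of `alpha (k + 1)`. -/
theorem exists_coeff_of_mem_posCone {q : ℤ →₀ ℤ} (h : q ∈ posCone) :
    ∃ c : ℤ →₀ ℤ, (∀ k, 0 ≤ c k) ∧ ∀ k, q k = c k + c (k - 2) := by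
  induction h using AddSubsemigroup.closure_induction with
  | mem x hx =>
    obtain ⟨l, rfl⟩ := hx
    refine ⟨Finsupp.single (l - 1) 1, fun k => ?_, fun k => ?_⟩
    · rw [Finsupp.single_apply]
      split_ifs <;> decide
    · rw [alpha_apply, Finsupp.single_apply, Finsupp.single_apply]
      simp only [show l - 1 = k - 2 ↔ l + 1 = k by omega]
  | add x y _ _ hx hy =>
    obtain ⟨c, h1, h2⟩ := hx
    obtain ⟨d, h3, h4⟩ := hy
    refine ⟨c + d, fun k => add_nonneg (h1 k) (h3 k), fun k => ?_⟩
    rw [Finsupp.add_apply, h2, h4, Finsupp.add_apply, Finsupp.add_apply]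
    ring

theorem u_eq_ite {m : DomMon} (hm : ∀ l : ℤ, m.1.u l ≤ 1)
    (k : ℤ) : m.1.u k = if k ∈ m.1.u.support then 1 else 0 := by
  have h1 := hm k
  have h2 := m.2 k
  split_ifs with h <;> rw [Finsupp.mem_support_iff] at h <;> omega

/-- Nonnegativity of `m'` gives `c ≤ u(m) ≤ 1`, so the multiplicities form the indicator function of
a subset of the support. -/
theorem exists_alphaSum_of_mem_lower {m : DomMon} (hm : ∀ l : ℤ, m.1.u l ≤ 1)
    {m' : DomMon} (h : m' ∈ lower m) :
    ∃ J ⊆ m.1.u.support, m.1.u - m'.1.u = alphaSum J := by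
  obtain ⟨c, hc, hq⟩ := exists_coeff_of_mem_posCone ((mem_lower_iff m m').1 h).2
  have hcu : ∀ k, c k ≤ m.1.u k := fun k => by
    have h1 := hq k
    have h2 := m'.2 k
    have h3 := hc (k - 2)
    rw [Finsupp.sub_apply] at h1
    omega
  have hci : ∀ k, c k = if k ∈ c.support then 1 else 0 := fun k => by
    have h1 := hcu k
    have h2 := hm k
    have h3 := hc k
    split_ifs with h <;> rw [Finsupp.mem_support_iff] at h <;> omega
  refine ⟨c.support, fun k hk => ?_, ?_⟩
  · have h1 := hcu k
    have h2 := hc k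
    rw [Finsupp.mem_support_iff] at *
    omega
  · ext k
    rw [hq, alphaSum_apply, ← hci, ← hci]

theorem u_le_one_of_mem_lower {m : DomMon} (hm : ∀ l : ℤ, m.1.u l ≤ 1)
    {m' : DomMon} (h : m' ∈ lower m) (l : ℤ) : m'.1.u l ≤ 1 := by
  obtain ⟨c, hc, hq⟩ := exists_coeff_of_mem_posCone ((mem_lower_iff m m').1 h).2
  have h1 := hq l
  have h2 := hc l
  have h3 := hc (l - 2)
  have h4 := hm l
  rw [Finsupp.sub_apply] at h1
  omega

theorem et_eq_sum {m : DomMon} (hm : ∀ l : ℤ, m.1.u l ≤ 1) :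
    Et m = ∑ J ∈ m.1.u.support.powerset,
    mon ⟨m.1.a - (J.filter fun l => l + 2 ∈ m.1.u.support \ J).card, m.1.u - alphaSum J⟩ := by
  have h1 : ∀ l ∈ m.1.u.support, (m.1.u l).toNat = 1 := fun l hl => by
    rw [u_eq_ite hm, if_pos hl]; rfl
  have hG := orderedProd_Y_u m
  rw [et_eq]
  rw [orderedProd_congr (h := YMon.Y) fun l hl => by rw [h1 l hl, pow_one]] at hG ⊢
  rw [orderedProd_congr (h := fund) fun l hl => by rw [h1 l hl, pow_one], orderedProd_fund,
    Finset.mul_sum]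
  set G := orderedProd m.1.u.support YMon.Y
  obtain ⟨k, hk⟩ : ∃ k, m.1 * G⁻¹ = YMon.t k := by
    refine ⟨(m.1 * G⁻¹).a, YMon.ext rfl ?_⟩
    rw [YMon.mul_u, YMon.inv_u, hG, add_neg_cancel]
    rfl
  have hmG : m.1.a = k + G.a := by
    rw [mul_inv_eq_iff_eq_mul, YMon.t_mul] at hk
    rw [hk]
  refine Finset.sum_congr rfl fun J _ => ?_
  rw [hk, mon_mul, YMon.t_mul, hG, hmG, add_sub_assoc]

/-- For `l ∈ J` the factor `A_{l+1}⁻¹` lowers the exponent at `l + 2`; to stay nonnegative it must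
have been `1` and not be lowered a second time through `l + 2 ∈ J`. -/
theorem card_filter_eq_card {m : DomMon} (hm : ∀ l : ℤ, m.1.u l ≤ 1)
    {J : Finset ℤ} {g : YMon} (hg : g.Dominant)
    (hJ : g.u = m.1.u - alphaSum J) :
    (J.filter fun l => l + 2 ∈ m.1.u.support \ J).card = J.card := by
  congr 1
  refine Finset.filter_true_of_mem fun l hl => ?_
  have h1 := hg (l + 2)
  rw [hJ, Finsupp.sub_apply, alphaSum_apply, add_sub_cancel_right, if_pos hl, u_eq_ite hm] at h1
  rw [Finset.mem_sdiff]
  by_contra h0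
  split_ifs at h1 <;> first | omega | tauto

theorem numA_eq_card {J : Finset ℤ} {m m' : DomMon} (hJ : m.1.u - m'.1.u = alphaSum J) :
    YMon.numA m'.1 m.1 = J.card := by
  refine YMon.numA_eq ?_
  rw [mul_inv_u, hJ]
  exact isAProd_neg_alphaSum J

theorem et_eq_ft_add_sum {m : DomMon} (hm : ∀ l : ℤ, m.1.u l ≤ 1) :
    Et m = Ft m + ∑ m' ∈ (lower_finite m).toFinset,
    scalar (LaurentPolynomial.T (-(YMon.numA m'.1 m.1 : ℤ))) * Ft m' := by
  classical
  refine (isUni_et m).inKt.ext ((isFt_ft m).1.add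
    (InKt.sum_scalar_mul _ fun m' _ => (isFt_ft m').1)) fun g hg => ?_
  have hterm : ∀ m' : DomMon,
      (scalar (LaurentPolynomial.T (-(YMon.numA m'.1 m.1 : ℤ))) * Ft m').coeff g =
        if g.u = m'.1.u then if -(YMon.numA m'.1 m.1 : ℤ) = g.a - m'.1.a then 1 else 0 else 0 :=
    fun m' => by rw [(isFt_ft m').coeff_scalar_mul _ hg, LaurentPolynomial.T_apply]
  rw [et_eq_sum hm, MonoidAlgebra.coeff_add, Finsupp.add_apply, MonoidAlgebra.coeff_sum,
    MonoidAlgebra.coeff_sum, Finsupp.finsetSum_apply, Finsupp.finsetSum_apply,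
    (isFt_ft m).coeff_eq hg]
  simp only [hterm, mon_coeff]
  -- At most one `J` produces the exponent vector of `g`: the empty set matches `F_t(m)`, a nonempty
  -- one matches a unique `m' ∈ lower m`, and without such a `J` both sides vanish at `g`.
  by_cases hex : ∃ J ⊆ m.1.u.support, g.u = m.1.u - alphaSum J
  · obtain ⟨J, hJs, hJ⟩ := hex
    rw [Finset.sum_eq_single_of_mem J (Finset.mem_powerset.2 hJs)]
    · rw [card_filter_eq_card hm hg hJ, ← hJ]
      by_cases hJ0 : J = ∅
      · subst hJ0
        have hu : g.u = m.1.u := by rw [hJ, alphaSum, Finset.sum_empty, sub_zero]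
        rw [Finset.sum_eq_zero, add_zero]
        · refine if_congr ?_ rfl rfl
          rw [YMon.ext_iff, YMon.ext_iff, Finset.card_empty]
          simp [hu, eq_comm]
        · intro m' hm'
          refine if_neg fun h => ?_
          have h1 := ((mem_lower_iff m m').1 ((Set.Finite.mem_toFinset _).1 hm')).2
          rw [← h, hu, sub_self] at h1
          exact ne_zero_of_mem_posCone h1 rfl
      · have hmem : m.1.u - g.u ∈ posCone := by
          have h1 := YMon.mem_posCone_of_isAProd (isAProd_neg_alphaSum J) (by
            intro h
            rw [neg_eq_zero] at h
            exact hJ0 (alphaSum_injective (h.trans (by rw [alphaSum, Finset.sum_empty]))))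
          rwa [neg_neg, ← sub_sub_cancel m.1.u (alphaSum J), ← hJ] at h1
        obtain ⟨m', hm', hu⟩ := exists_mem_lower hg hmem
        have hne : g ≠ m.1 := by
          rintro rfl
          rw [sub_self] at hmem
          exact ne_zero_of_mem_posCone hmem rfl
        rw [if_neg hne, zero_add,
          Finset.sum_eq_single_of_mem m' ((Set.Finite.mem_toFinset _).2 hm'), if_pos hu.symm,
          numA_eq_card (J := J) (by rw [hu, hJ, sub_sub_cancel]),
          ((mem_lower_iff m m').1 hm').1]
        · refine if_congr ?_ rfl rfl
          rw [YMon.ext_iff]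
          simp only [and_true]
          omega
        · intro m'' hm'' hne
          refine if_neg fun h => hne ?_
          exact eq_of_mem_lower ((Set.Finite.mem_toFinset _).1 hm'') hm' (by rw [hu, h])
    · intro K _ hne
      refine if_neg fun h => hne (alphaSum_injective ?_)
      have h1 := congrArg YMon.u h
      rw [hJ] at h1
      exact sub_right_injective h1
  · rw [Finset.sum_eq_zero, if_neg, Finset.sum_eq_zero, add_zero]
    · intro m' hm'
      refine if_neg fun h => hex ?_
      obtain ⟨J, hJs, hJ⟩ := exists_alphaSum_of_mem_lower hm ((Set.Finite.mem_toFinset _).1 hm')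
      exact ⟨J, hJs, by rw [h, ← hJ, sub_sub_cancel]⟩
    · rintro rfl
      exact hex ⟨∅, Finset.empty_subset _, by rw [alphaSum, Finset.sum_empty, sub_zero]⟩
    · intro J hJ
      exact if_neg fun h => hex ⟨J, Finset.mem_powerset.1 hJ, (congrArg YMon.u h).symm⟩

theorem one_le_numA_and_isAProd {m m' : DomMon} (h : m' ∈ lower m) :
    1 ≤ YMon.numA m'.1 m.1 ∧ YMon.IsAProd (YMon.numA m'.1 m.1) (m'.1 * m.1⁻¹).u := by
  obtain ⟨R, h1, h2⟩ := YMon.isAProd_neg_of_mem ((mem_lower_iff m m').1 h).2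
  rw [← mul_inv_u] at h2
  rw [YMon.numA_eq h2]
  exact ⟨h1, h2⟩

/-- The coefficients `t^{-R(m')}` have negative exponent because `R(m') ≥ 1`, so the expansion of
`E_t(m)` in the `F_t` already has Kazhdan–Lusztig form; the induction applies as `lower m` stays
multiplicity-free. -/
theorem lt_eq_ft_and_klPoly_eq {m : DomMon} (hm : ∀ l : ℤ, m.1.u l ≤ 1) :
    Lt m = Ft m ∧ ∀ m' ∈ lower m,
      KLpoly m' m = LaurentPolynomial.T (-(YMon.numA m'.1 m.1 : ℤ)) := by
  induction hd : domDeg m using Nat.strong_induction_on generalizing m with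
  | _ d ih =>
    subst hd
    refine isKL_klPair.eq_of_eqOn_lower (L' := Ft)
      (fun m' hm' => (ih _ (domDeg_lt hm') (u_le_one_of_mem_lower hm hm') rfl).1)
      (isBarInv_ft m) (fun m' hm' n hn => ?_) (et_eq_ft_add_sum hm)
    have := (one_le_numA_and_isAProd hm').1
    rw [LaurentPolynomial.T_apply, if_neg (by omega)]

end QTsl2

theorem mainTheorem9 :
    (∀ m : QTsl2.DomMon, ∃! x, QTsl2.IsFt m x) ∧
    (∃! q : (QTsl2.DomMon → QTsl2.Yt) ×
        (QTsl2.DomMon → QTsl2.DomMon → LaurentPolynomial ℤ), QTsl2.IsKL q.1 q.2) ∧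
    ∀ m : QTsl2.DomMon, (∀ l : ℤ, m.1.u l ≤ 1) →
      QTsl2.Lt m = QTsl2.Ft m ∧
      (∀ m' ∈ QTsl2.lower m,
        1 ≤ QTsl2.YMon.numA m'.1 m.1 ∧
        QTsl2.YMon.IsAProd (QTsl2.YMon.numA m'.1 m.1) (m'.1 * m.1⁻¹).u) ∧
      QTsl2.Et m = QTsl2.Lt m + ∑ m' ∈ (QTsl2.lower_finite m).toFinset,
        QTsl2.scalar (LaurentPolynomial.T (-(QTsl2.YMon.numA m'.1 m.1 : ℤ))) * QTsl2.Lt m' ∧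
      ∀ m' ∈ QTsl2.lower m,
        QTsl2.KLpoly m' m = LaurentPolynomial.T (-(QTsl2.YMon.numA m'.1 m.1 : ℤ)) := by
  refine ⟨fun m => ⟨QTsl2.Ft m, QTsl2.isFt_ft m, fun y hy => hy.unique (QTsl2.isFt_ft m)⟩, ?_,
    fun m hm => ?_⟩
  · obtain ⟨q, hq⟩ := QTsl2.exists_isKL
    exact ⟨q, hq, fun q' hq' => Prod.ext (hq'.unique hq).1 (hq'.unique hq).2⟩
  · obtain ⟨hL, hP⟩ := QTsl2.lt_eq_ft_and_klPoly_eq hm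
    refine ⟨hL, fun m' hm' => QTsl2.one_le_numA_and_isAProd hm', ?_, hP⟩
    rw [hL, QTsl2.et_eq_ft_add_sum hm]
    congr 1
    refine Finset.sum_congr rfl fun m' hm' => ?_
    have hm'' := (Set.Finite.mem_toFinset _).1 hm'
    rw [(QTsl2.lt_eq_ft_and_klPoly_eq (QTsl2.u_le_one_of_mem_lower hm hm'')).1]
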